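/- Let $m\ge 2$ and $k\ge 2$ be integers. Let $\sigma_m$ be the morphism on finite words over the alphabet $\{0,\dots,m-1\}$ given by $\sigma_m(i)=i\,(i+1)\cdots(i+m-1)$, letters being reduced modulo $m$, and let $\mathbf t_m=\lim_{j\to\infty}\sigma_m^j(0)$ be the generalized Thue--Morse word. For finite words $u,x$ let $\binom{u}{x}$ be the number of occurrences of $x$ as a subword (i.e. a not necessarily contiguous subsequence) of $u$, and call two words $u,v$ $k$-binomially equivalent if $\binom{u}{x}=\binom{v}{x}$ for every word $x$ of length at most $k$. Let $b^{(k)}_{\mathbf t_m}(n)$ denote the number of $k$-binomial equivalence classes of factors (i.e. contiguous subwords) of length $n$ of $\mathbf t_m$. Then the sequence $\bigl(b^{(k)}_{\mathbf t_m}(n)\bigr)_{n\ge m^k}$ is periodic with period $m^k$, that is, $b^{(k)}_{\mathbf t_m}(n+m^k)=b^{(k)}_{\mathbf t_m}(n)$ for every $n\ge m^k$. (For $k\ge 3$ this confirms the conjecture of Lü, Chen, Wen and Wu.) -/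

import Mathlib

namespace GenThueMorse

/-- The image of a letter under the symmetric morphism `σ_m`:
`i ↦ i (i+1) ⋯ (i+m-1)`, letters being taken modulo `m`. -/
def sigmaLetter (m : ℕ) (i : ZMod m) : List (ZMod m) :=
  (List.range m).map fun r => i + (r : ZMod m)

/-- The morphism `σ_m` on finite words over the alphabet `{0, …, m-1}`. -/
def sigma (m : ℕ) (u : List (ZMod m)) : List (ZMod m) :=
  u.flatMap (sigmaLetter m)

/-- The generalized Thue–Morse word `t_m = lim_j σ_m^j(0)` (for `m ≥ 2`). Its letter at
position `n` is read in `σ_m^n(0)`, which has length `m ^ n > n`; see `sigma_iterate_eq` below: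
every `σ_m^j(0)` is a prefix of `t_m`. -/
def thueMorse (m : ℕ) (n : ℕ) : ZMod m :=
  ((sigma m)^[n] [0]).getD n 0

/-- The factor of length `n` of the infinite word `w` starting at position `i`. -/
def factorAt {A : Type*} (w : ℕ → A) (i n : ℕ) : List A :=
  (List.range n).map fun j => w (i + j)

/-- The set of factors of length `n` of the infinite word `w`. -/
def factors {A : Type*} (w : ℕ → A) (n : ℕ) : Set (List A) :=
  {u | ∃ i, u = factorAt w i n}

/-- The binomial coefficient of words: the number of occurrences of `x` as a (scattered)
subword of `u`. The list `u.sublists` has one entry for each set of positions of `u`. -/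
def binom {A : Type*} [DecidableEq A] (u x : List A) : ℕ :=
  u.sublists.count x

/-- `k`-binomial equivalence of finite words. -/
def BinomEquiv {A : Type*} [DecidableEq A] (k : ℕ) (u v : List A) : Prop :=
  ∀ x : List A, x.length ≤ k → binom u x = binom v x

/-- `k`-binomial equivalence, as an equivalence relation on the factors of length `n`. -/
def factorSetoid {A : Type*} [DecidableEq A] (k : ℕ) (w : ℕ → A) (n : ℕ) :
    Setoid (factors w n) where
  r u v := BinomEquiv k (u : List A) (v : List A)
  iseqv :=
    ⟨fun _ _ _ => rfl, fun h x hx => (h x hx).symm, fun h h' x hx => (h x hx).trans (h' x hx)⟩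

/-- The `k`-binomial complexity function of the infinite word `w` (over a finite alphabet):
the number of `k`-binomial equivalence classes of factors of length `n`. -/
noncomputable def binomComplexity {A : Type*} [DecidableEq A] (k : ℕ) (w : ℕ → A) (n : ℕ) : ℕ :=
  Nat.card (Quotient (factorSetoid k w n))

theorem length_sigma (m : ℕ) (u : List (ZMod m)) : (sigma m u).length = m * u.length := by
  induction u with
  | nil => simp [sigma]
  | cons a u ih =>
    simp only [sigma, List.flatMap_cons, List.length_append] at ih ⊢
    rw [ih]
    simp [sigmaLetter]
    ring

theorem length_sigma_iterate (m j : ℕ) : ((sigma m)^[j] [0]).length = m ^ j := by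
  induction j with
  | zero => simp
  | succ j ih => rw [Function.iterate_succ_apply', length_sigma, ih, pow_succ, mul_comm]

theorem sigma_iterate_prefix_succ {m : ℕ} (hm : 2 ≤ m) (j : ℕ) :
    (sigma m)^[j] [0] <+: (sigma m)^[j + 1] [0] := by
  induction j with
  | zero =>
    obtain ⟨m, rfl⟩ : ∃ m', m = m' + 1 := ⟨m - 1, by omega⟩
    simp [sigma, sigmaLetter, List.range_succ_eq_map]
  | succ j ih =>
    rw [Function.iterate_succ_apply', Function.iterate_succ_apply' (n := j + 1)]
    obtain ⟨s, hs⟩ := ih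
    exact ⟨sigma m s, by rw [← hs]; simp [sigma]⟩

theorem sigma_iterate_prefix {m : ℕ} (hm : 2 ≤ m) {i j : ℕ} (h : i ≤ j) :
    (sigma m)^[i] [0] <+: (sigma m)^[j] [0] := by
  induction j, h using Nat.le_induction with
  | base => exact List.prefix_rfl
  | succ j _ ih => exact ih.trans (sigma_iterate_prefix_succ hm j)

/-- Every `σ_m^j(0)` is the prefix of length `m ^ j` of `t_m`, so that `t_m` is their limit. -/
theorem sigma_iterate_eq {m : ℕ} (hm : 2 ≤ m) (j : ℕ) :
    (sigma m)^[j] [0] = factorAt (thueMorse m) 0 (m ^ j) := by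
  apply List.ext_getElem
  · simp [factorAt, length_sigma_iterate]
  · intro n h1 h2
    have h3 : n < ((sigma m)^[n] [0]).length := by
      rw [length_sigma_iterate]; exact Nat.lt_pow_self (by omega)
    simp only [factorAt, List.getElem_map, List.getElem_range, Nat.zero_add, thueMorse]
    rw [List.getD_eq_getElem _ _ h3]
    rcases le_total n j with h | h
    · exact ((sigma_iterate_prefix hm h).getElem h3).symm
    · exact (sigma_iterate_prefix hm h).getElem h1

end GenThueMorse

/-! Put k = j + 1 and B = m^j, and cut t_m into blocks of length B, the images of its letters under
σ_m^j. The core is a rigid description of k-binomial equivalence: for n ≥ m^k, two factors of length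
n are equivalent exactly when they are `Aligned`, that is, they start at the same offset modulo B,
have the same partial blocks at both ends, and contain the same blocks up to order.

Alignment suffices (`binomEquiv_of_aligned`). Images of two letters under σ_m^j are j-binomially
equivalent, and j-equivalent words commute up to (j+1)-equivalence, so permuting blocks is harmless
(`BinomEquiv.sigma_iterate_of_perm`).

Alignment is necessary (`aligned_of_binomEquiv`), by induction on j. Suppose alignment is known for
blocks of length m^j. After cancelling the partial blocks there remain σ_m^j(x) and σ_m^j(y), with x
a permutation of y, both factors of t_m. Counts of words of length j + 2 in these images are linear
in the position sums of the letters of x and y, and an independence argument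
(`eq_zero_of_sum_letterBinom_eq`) recovers those sums (`suffixWeight_eq_of_binomEquiv`). For long
factors of t_m, letter counts and position sums determine the decomposition into σ_m-blocks up to
order (`alignment_of_weights_eq`). Composing the two levels gives alignment for m^(j+1).

Periodicity is then formal. Alignment depends only on the offset modulo m^k, the two letters of t_m
indexing the blocks of length m^k at the ends, and n (`aligned_iff_dataRel`). For n ≥ m^k every such
triple occurs (`factorData_surjective`), and the relation between triples is unchanged when n grows
by m^k (`dataRel_add_period`). -/

namespace GenThueMorse

/-! ### Binomial coefficients of words and k-binomial equivalence -/

section Binom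

variable {A : Type*} [DecidableEq A]

theorem binom_eq_count_sublists' (u x : List A) : binom u x = u.sublists'.count x :=
  (List.sublists_perm_sublists' u).count_eq x

theorem binom_nil_right (u : List A) : binom u [] = 1 := by
  rw [binom_eq_count_sublists']
  induction u with
  | nil => simp
  | cons a u ih =>
    rw [List.sublists'_cons, List.count_append, ih, Nat.add_eq_left, List.count_eq_zero]
    simp

theorem binom_nil_cons (b : A) (w : List A) : binom [] (b :: w) = 0 := by
  simp [binom]

theorem binom_cons_cons (a : A) (u : List A) (b : A) (w : List A) :
    binom (a :: u) (b :: w) = binom u (b :: w) + if a = b then binom u w else 0 := by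
  simp only [binom_eq_count_sublists', List.sublists'_cons, List.count_append]
  congr 1
  split_ifs with h
  · subst h
    exact List.count_map_of_injective _ _ (List.cons_injective) _
  · rw [List.count_eq_zero]
    simp [h]

theorem binom_singleton (u : List A) (a : A) : binom u [a] = u.count a := by
  induction u with
  | nil => simp [binom_nil_cons]
  | cons b u ih =>
    rw [binom_cons_cons, ih, binom_nil_right, List.count_cons]
    simp

/-- The number of occurrences of a subword in a concatenation. -/
theorem binom_append (u v w : List A) :
    binom (u ++ v) w =
      ∑ i ∈ Finset.range (w.length + 1), binom u (w.take i) * binom v (w.drop i) := by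
  induction u generalizing w with
  | nil =>
    rw [Finset.sum_range_succ', Finset.sum_eq_zero]
    · simp [binom_nil_right]
    · intro i hi
      cases w with
      | nil => simp at hi
      | cons b w => simp [binom_nil_cons]
  | cons a u ih =>
    cases w with
    | nil => simp [binom_nil_right]
    | cons b w =>
      rw [List.cons_append, binom_cons_cons, ih, List.length_cons, Finset.sum_range_succ',
        Finset.sum_range_succ' (n := w.length + 1)]
      simp only [List.take_succ_cons, List.drop_succ_cons, List.take_zero, List.drop_zero,
        binom_nil_right, binom_cons_cons, add_mul, Finset.sum_add_distrib]
      split_ifs with h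
      · rw [ih]; ring
      · simp

theorem BinomEquiv.refl (k : ℕ) (u : List A) : BinomEquiv k u u := fun _ _ => rfl

theorem BinomEquiv.symm {k : ℕ} {u v : List A} (h : BinomEquiv k u v) : BinomEquiv k v u :=
  fun x hx => (h x hx).symm

theorem BinomEquiv.trans {k : ℕ} {u v w : List A} (h : BinomEquiv k u v)
    (h' : BinomEquiv k v w) : BinomEquiv k u w :=
  fun x hx => (h x hx).trans (h' x hx)

theorem BinomEquiv.mono {k l : ℕ} (hkl : k ≤ l) {u v : List A} (h : BinomEquiv l u v) :
    BinomEquiv k u v :=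
  fun x hx => h x (hx.trans hkl)

theorem BinomEquiv.append {k : ℕ} {u v u' v' : List A} (h : BinomEquiv k u u')
    (h' : BinomEquiv k v v') : BinomEquiv k (u ++ v) (u' ++ v') := by
  intro x hx
  rw [binom_append, binom_append]
  refine Finset.sum_congr rfl fun i _ => ?_
  rw [h _ (by simp; omega), h' _ (by simp; omega)]

/-- In the expansion of `binom_append`, the cut with empty left part gives the coefficient of `x`
itself with factor 1; all other cuts involve shorter words, so induction on the length of `x`
isolates it. -/
theorem BinomEquiv.cancel_left {k : ℕ} {p u v : List A}
    (h : BinomEquiv k (p ++ u) (p ++ v)) : BinomEquiv k u v := by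
  intro x hx
  induction hl : x.length using Nat.strong_induction_on generalizing x with
  | _ n ih =>
    have := h x hx
    rw [binom_append, binom_append, Finset.sum_range_succ', Finset.sum_range_succ'] at this
    simp only [List.take_zero, binom_nil_right, List.drop_zero, one_mul] at this
    refine Nat.add_left_cancel (this.trans ?_)
    congr 1
    refine Finset.sum_congr rfl fun i hi => ?_
    rw [Finset.mem_range] at hi
    rw [ih (x.length - (i + 1)) (by omega) (x.drop (i + 1)) (by simp; omega) (by simp)]

theorem BinomEquiv.cancel_right {k : ℕ} {p u v : List A}
    (h : BinomEquiv k (u ++ p) (v ++ p)) : BinomEquiv k u v := by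
  intro x hx
  induction hl : x.length using Nat.strong_induction_on generalizing x with
  | _ n ih =>
    have := h x hx
    rw [binom_append, binom_append, Finset.sum_range_succ, Finset.sum_range_succ] at this
    simp only [List.take_length, binom_nil_right, List.drop_length, mul_one] at this
    refine Nat.add_left_cancel (this.trans ?_)
    congr 1
    refine Finset.sum_congr rfl fun i hi => ?_
    rw [Finset.mem_range] at hi
    rw [ih i (by omega) (x.take i) (by simp; omega) (by simp; omega)]

theorem binomEquiv_one_iff_perm {u v : List A} : BinomEquiv 1 u v ↔ u.Perm v := by
  rw [List.perm_iff_count]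
  constructor
  · intro h a
    rw [← binom_singleton, ← binom_singleton, h _ (by simp)]
  · intro h x hx
    match x, hx with
    | [], _ => simp [binom_nil_right]
    | [a], _ => simp [binom_singleton, h]

/-- Words that are `k`-binomially equivalent commute up to `k + 1`-binomial equivalence. -/
theorem BinomEquiv.append_comm {k : ℕ} {u v : List A} (h : BinomEquiv k u v) :
    BinomEquiv (k + 1) (u ++ v) (v ++ u) := by
  intro x hx
  match x, hx with
  | [], _ => simp [binom_nil_right]
  | b :: x, hx =>
    rw [binom_append, binom_append, Finset.sum_range_succ, Finset.sum_range_succ, List.length_cons,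
      Finset.sum_range_succ', Finset.sum_range_succ']
    simp only [List.length_cons] at hx
    have : ∀ i ∈ Finset.range x.length,
        binom u ((b :: x).take (i + 1)) * binom v ((b :: x).drop (i + 1)) =
          binom v ((b :: x).take (i + 1)) * binom u ((b :: x).drop (i + 1)) := by
      intro i hi
      rw [Finset.mem_range] at hi
      rw [h _ (by simp; omega), h _ (by simp; omega)]
    rw [Finset.sum_congr rfl this]
    simp only [List.take_zero, List.drop_zero, binom_nil_right, ← List.length_cons (a := b),
      List.take_length, List.drop_length]
    ring

end Binom

/-! ### The morphism σ_m and the equivalence of its iterated images -/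

section Sigma

variable {m : ℕ}

theorem sigma_append (u v : List (ZMod m)) : sigma m (u ++ v) = sigma m u ++ sigma m v := by
  simp [sigma]

theorem sigma_iterate_append (j : ℕ) (u v : List (ZMod m)) :
    (sigma m)^[j] (u ++ v) = (sigma m)^[j] u ++ (sigma m)^[j] v := by
  induction j generalizing u v with
  | zero => rfl
  | succ j ih => rw [Function.iterate_succ_apply, sigma_append, ih]; rfl

theorem sigma_iterate_cons (j : ℕ) (a : ZMod m) (u : List (ZMod m)) :
    (sigma m)^[j] (a :: u) = (sigma m)^[j] [a] ++ (sigma m)^[j] u :=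
  sigma_iterate_append j [a] u

theorem sigma_singleton (a : ZMod m) : sigma m [a] = sigmaLetter m a := by simp [sigma]

theorem sum_range_natCast [NeZero m] {M : Type*} [AddCommMonoid M] (f : ZMod m → M) :
    ∑ r ∈ Finset.range m, f (r : ZMod m) = ∑ a, f a := by
  refine Finset.sum_bij' (fun r _ => (r : ZMod m)) (fun a _ => a.val) ?_ ?_ ?_ ?_ ?_
  · simp
  · intro a _; simpa using ZMod.val_lt a
  · intro r hr; exact ZMod.val_cast_of_lt (Finset.mem_range.1 hr)
  · intro a _; simp
  · simp

theorem sum_range_add_natCast [NeZero m] {M : Type*} [AddCommMonoid M] (f : ZMod m → M)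
    (a : ZMod m) : ∑ r ∈ Finset.range m, f (a + r) = ∑ a, f a := by
  rw [sum_range_natCast fun r => f (a + r)]
  exact Fintype.sum_equiv (Equiv.addLeft a) _ _ fun _ => rfl

theorem sum_map_range {M : Type*} [AddCommMonoid M] (f : ℕ → M) (n : ℕ) :
    ((List.range n).map f).sum = ∑ r ∈ Finset.range n, f r := by
  induction n with
  | zero => simp
  | succ n ih => rw [List.range_succ, List.map_append, List.sum_append, ih,
      Finset.sum_range_succ]; simp

theorem count_eq_sum_map {A : Type*} [DecidableEq A] (u : List A) (b : A) :
    u.count b = (u.map fun a => if a = b then 1 else 0).sum := by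
  induction u with
  | nil => simp
  | cons a u ih => rw [List.count_cons, ih, List.map_cons, List.sum_cons, add_comm]; simp

theorem sigmaLetter_eq (a : ZMod m) :
    sigmaLetter m a = (List.range m).map fun r : ℕ => a + (r : ZMod m) := by
  simp [sigmaLetter, ← List.map_eq_flatMap]

theorem count_sigmaLetter [NeZero m] (a b : ZMod m) : (sigmaLetter m a).count b = 1 := by
  rw [count_eq_sum_map, sigmaLetter_eq, List.map_map, sum_map_range]
  simp only [Function.comp]
  rw [sum_range_add_natCast fun c => if c = b then 1 else 0]
  simp

theorem count_sigma [NeZero m] (u : List (ZMod m)) (b : ZMod m) :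
    (sigma m u).count b = u.length := by
  induction u with
  | nil => simp [sigma]
  | cons a u ih =>
    have : sigma m (a :: u) = sigmaLetter m a ++ sigma m u := by simp [sigma]
    rw [this, List.count_append, ih, count_sigmaLetter, List.length_cons, add_comm]

theorem length_sigma_iterate' (j : ℕ) (u : List (ZMod m)) :
    ((sigma m)^[j] u).length = m ^ j * u.length := by
  induction j with
  | zero => simp
  | succ j ih => rw [Function.iterate_succ_apply', length_sigma, ih]; ring

theorem count_sigma_iterate_succ [NeZero m] (j : ℕ) (u : List (ZMod m)) (b : ZMod m) :
    ((sigma m)^[j + 1] u).count b = m ^ j * u.length := by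
  rw [Function.iterate_succ_apply', count_sigma, length_sigma_iterate']

theorem perm_sigma_of_length_eq [NeZero m] {x y : List (ZMod m)} (h : x.length = y.length) :
    (sigma m x).Perm (sigma m y) := by
  rw [List.perm_iff_count]
  intro b
  rw [count_sigma, count_sigma, h]

/-- Adjacent transpositions suffice. Images of single letters under σ_m are permutations of each
other, so the inductive hypothesis makes the two swapped blocks equivalent one order lower, and
`BinomEquiv.append_comm` gains the missing order. -/
theorem BinomEquiv.sigma_iterate_of_perm [NeZero m] (j : ℕ) {x y : List (ZMod m)}
    (h : x.Perm y) : BinomEquiv (j + 1) ((sigma m)^[j] x) ((sigma m)^[j] y) := by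
  induction j generalizing x y with
  | zero => exact binomEquiv_one_iff_perm.2 h
  | succ j ih =>
    induction h with
    | nil => exact BinomEquiv.refl _ _
    | @cons a l₁ l₂ _ ih' =>
      rw [sigma_iterate_cons _ a l₁, sigma_iterate_cons _ a l₂]
      exact (BinomEquiv.refl _ _).append ih'
    | swap a b l =>
      have hab : BinomEquiv (j + 1) ((sigma m)^[j + 1] [b]) ((sigma m)^[j + 1] [a]) := by
        rw [Function.iterate_succ_apply, Function.iterate_succ_apply]
        exact ih (perm_sigma_of_length_eq (by simp))
      rw [sigma_iterate_cons, sigma_iterate_cons _ a, sigma_iterate_cons _ a (b :: l),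
        sigma_iterate_cons _ b l, ← List.append_assoc, ← List.append_assoc]
      exact hab.append_comm.append (BinomEquiv.refl _ _)
    | trans _ _ h1 h2 => exact h1.trans h2

theorem BinomEquiv.sigma_iterate_of_length_eq [NeZero m] (j : ℕ) {x y : List (ZMod m)}
    (h : x.length = y.length) : BinomEquiv j ((sigma m)^[j] x) ((sigma m)^[j] y) := by
  cases j with
  | zero =>
    intro w hw
    rw [List.length_eq_zero_iff.1 (Nat.le_zero.1 hw), binom_nil_right, binom_nil_right]
  | succ j =>
    rw [Function.iterate_succ_apply, Function.iterate_succ_apply]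
    exact BinomEquiv.sigma_iterate_of_perm j (perm_sigma_of_length_eq h)

end Sigma

/-! ### Position-weighted letter sums -/

section Weight

variable {A : Type*}

/-- The sum of `h` over the letters of a word, each letter being weighted by the number of
letters that follow it. -/
def suffixWeight (h : A → ℤ) : List A → ℤ
  | [] => 0
  | a :: x => x.length * h a + suffixWeight h x

theorem suffixWeight_sub (h g : A → ℤ) (x : List A) :
    suffixWeight (fun a => h a - g a) x = suffixWeight h x - suffixWeight g x := by
  induction x with
  | nil => simp [suffixWeight]
  | cons a x ih => simp only [suffixWeight, ih]; ring

theorem suffixWeight_const (c : ℤ) {x y : List A} (h : x.length = y.length) :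
    suffixWeight (fun _ => c) x = suffixWeight (fun _ => c) y := by
  induction x generalizing y with
  | nil => rw [List.length_eq_zero_iff.1 h.symm]
  | cons a x ih =>
    cases y with
    | nil => simp at h
    | cons b y =>
      simp only [List.length_cons, Nat.add_right_cancel_iff] at h
      rw [suffixWeight, suffixWeight, ih h, h]

theorem suffixWeight_eq_sum [Fintype A] [DecidableEq A] (h : A → ℤ) (x : List A) :
    suffixWeight h x = ∑ b, suffixWeight (fun a => if a = b then 1 else 0) x * h b := by
  induction x with
  | nil => simp [suffixWeight]
  | cons a x ih =>
    simp only [suffixWeight, add_mul, Finset.sum_add_distrib, ← ih]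
    simp

theorem suffixWeight_map_range (h : A → ℤ) (f : ℕ → A) (n : ℕ) :
    suffixWeight h ((List.range n).map f) =
      ∑ r ∈ Finset.range n, ((n : ℤ) - 1 - r) * h (f r) := by
  induction n generalizing f with
  | zero => simp [suffixWeight]
  | succ n ih =>
    rw [List.range_succ_eq_map, List.map_cons, List.map_map, suffixWeight, ih,
      Finset.sum_range_succ']
    simp only [List.length_map, List.length_range, Function.comp, Nat.succ_eq_add_one]
    push_cast
    rw [add_comm]
    congr 1
    · exact Finset.sum_congr rfl fun r _ => by ring
    · ring

/-- Letting the second letter be free, each occurrence of `b` is paired with every letter after it.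
-/
theorem sum_binom_pair [Fintype A] [DecidableEq A] (x : List A) (b : A) :
    ∑ c, (binom x [b, c] : ℤ) = suffixWeight (fun a => if a = b then 1 else 0) x := by
  induction x with
  | nil => simp [suffixWeight, binom_nil_cons]
  | cons a x ih =>
    have : ∑ c, (x.count c : ℤ) = x.length := by
      have := Multiset.toFinset_sum_count_eq (x : Multiset A)
      rw [Finset.sum_subset (Finset.subset_univ _)] at this
      · simpa using congrArg (Nat.cast : ℕ → ℤ) this
      · intro c _ hc; simpa [List.count_eq_zero] using hc
    simp only [binom_cons_cons, Nat.cast_add, Finset.sum_add_distrib, ih, suffixWeight]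
    split_ifs
    · simp only [binom_singleton, this]; ring
    · simp

end Weight

/-! ### Differences of binomial coefficients just above the order of equivalence -/

section Differences

variable {A : Type*} [DecidableEq A]

theorem binom_append_sub_of_length_eq_succ {J : ℕ} {u u' v v' w : List A}
    (hu : BinomEquiv J u u') (hv : BinomEquiv J v v') (hw : w.length = J + 1) :
    (binom (u ++ v) w : ℤ) - binom (u' ++ v') w =
      ((binom u w : ℤ) - binom u' w) + ((binom v w : ℤ) - binom v' w) := by
  have key : ∀ i ∈ Finset.range J,
      binom u (w.take (i + 1)) * binom v (w.drop (i + 1)) =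
        binom u' (w.take (i + 1)) * binom v' (w.drop (i + 1)) := by
    intro i hi
    rw [Finset.mem_range] at hi
    rw [hu _ (by simp; omega), hv _ (by simp; omega)]
  rw [binom_append, binom_append, hw, Finset.sum_range_succ, Finset.sum_range_succ',
    Finset.sum_range_succ, Finset.sum_range_succ', Finset.sum_congr rfl key, ← hw]
  simp only [List.take_zero, List.drop_zero, List.take_length, List.drop_length, binom_nil_right]
  push_cast
  ring

/-- The word has length j + 3. A cut leaving at least two letters on each side gives two pieces of
length at most j + 1, whose contributions cancel; only the two trivial cuts and the cuts next to the
first and last letters survive. -/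
theorem binom_append_sub_of_length_eq {j : ℕ} {u u' x x' v : List A} {b b' : A}
    (hu : BinomEquiv (j + 1) u u') (hx : BinomEquiv (j + 1) x x') (hv : v.length = j + 1) :
    (binom (u ++ x) (b :: (v ++ [b'])) : ℤ) - binom (u' ++ x') (b :: (v ++ [b'])) =
      ((binom u (b :: (v ++ [b'])) : ℤ) - binom u' (b :: (v ++ [b']))) +
      ((binom x (b :: (v ++ [b'])) : ℤ) - binom x' (b :: (v ++ [b']))) +
      (u.count b : ℤ) * ((binom x (v ++ [b']) : ℤ) - binom x' (v ++ [b'])) +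
      ((binom u (b :: v) : ℤ) - binom u' (b :: v)) * x.count b' := by
  have hub : binom u [b] = binom u' [b] := hu _ (by simp)
  have hxb : binom x [b'] = binom x' [b'] := hx _ (by simp)
  have h1 : (b :: (v ++ [b'])).length = j + 3 := by simp; omega
  have ht : (b :: (v ++ [b'])).take (j + 2) = b :: v := by
    rw [List.take_succ_cons, ← hv, List.take_left]
  have hd : (b :: (v ++ [b'])).drop (j + 2) = [b'] := by
    rw [List.drop_succ_cons, ← hv, List.drop_left]
  have key : ∀ i ∈ Finset.range j,
      binom u ((b :: (v ++ [b'])).take (i + 1 + 1)) * binom x ((b :: (v ++ [b'])).drop (i + 1 + 1))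
      = binom u' ((b :: (v ++ [b'])).take (i + 1 + 1)) *
        binom x' ((b :: (v ++ [b'])).drop (i + 1 + 1)) := by
    intro i hi
    rw [Finset.mem_range] at hi
    rw [hu _ (by rw [List.length_take]; omega), hx _ (by rw [List.length_drop]; omega)]
  have h2 : (b :: (v ++ [b'])).take (j + 3) = b :: (v ++ [b']) := by rw [← h1, List.take_length]
  have h3 : (b :: (v ++ [b'])).drop (j + 3) = [] := by rw [← h1, List.drop_length]
  rw [binom_append, binom_append, h1, Finset.sum_range_succ, Finset.sum_range_succ,
    Finset.sum_range_succ', Finset.sum_range_succ', Finset.sum_congr rfl key,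
    Finset.sum_range_succ (n := j + 3), Finset.sum_range_succ (n := j + 2),
    Finset.sum_range_succ' (n := j + 1), Finset.sum_range_succ' (n := j), ht, hd, h2, h3]
  simp only [zero_add, List.take_zero, List.drop_zero, List.take_succ_cons, List.drop_succ_cons,
    binom_nil_right, ← binom_singleton, hub, hxb]
  push_cast
  ring

end Differences

/-! ### Recovering position weights from binomial coefficients of images under σ_m^j -/

section Letters

variable {m : ℕ}

/-- The number of occurrences of `w` in the image of the letter `a` under `σ_m^j`. -/
def letterBinom (m j : ℕ) (w : List (ZMod m)) (a : ZMod m) : ℤ :=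
  binom ((sigma m)^[j] [a]) w

theorem binom_sigma_iterate_sub_of_length_eq_succ [NeZero m] (j : ℕ) {x y w : List (ZMod m)}
    (hxy : x.length = y.length) (hw : w.length = j + 1) :
    (binom ((sigma m)^[j] x) w : ℤ) - binom ((sigma m)^[j] y) w =
      (x.map (letterBinom m j w)).sum - (y.map (letterBinom m j w)).sum := by
  induction x generalizing y with
  | nil => rw [List.length_eq_zero_iff.1 hxy.symm]; simp
  | cons a x ih =>
    cases y with
    | nil => simp at hxy
    | cons b y =>
      simp only [List.length_cons, Nat.add_right_cancel_iff] at hxy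
      rw [sigma_iterate_cons, sigma_iterate_cons _ b, binom_append_sub_of_length_eq_succ
        (BinomEquiv.sigma_iterate_of_length_eq j (by simp))
        (BinomEquiv.sigma_iterate_of_length_eq j hxy) hw, ih hxy]
      simp only [List.map_cons, List.sum_cons, letterBinom]
      ring

theorem binom_sigma_iterate_sub [NeZero m] (j : ℕ) {x y v : List (ZMod m)} {b b' : ZMod m}
    (hxy : x.length = y.length) (hv : v.length = j + 1) :
    (binom ((sigma m)^[j + 1] x) (b :: (v ++ [b'])) : ℤ) -
        binom ((sigma m)^[j + 1] y) (b :: (v ++ [b'])) =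
      (x.map (letterBinom m (j + 1) (b :: (v ++ [b'])))).sum -
        (y.map (letterBinom m (j + 1) (b :: (v ++ [b'])))).sum +
      (m : ℤ) ^ j * (suffixWeight (letterBinom m (j + 1) (b :: v)) x -
        suffixWeight (letterBinom m (j + 1) (b :: v)) y) +
      (m : ℤ) ^ j * (((x.length : ℤ) - 1) * ((x.map (letterBinom m (j + 1) (v ++ [b']))).sum -
        (y.map (letterBinom m (j + 1) (v ++ [b']))).sum) -
        (suffixWeight (letterBinom m (j + 1) (v ++ [b'])) x -
          suffixWeight (letterBinom m (j + 1) (v ++ [b'])) y)) := by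
  induction x generalizing y with
  | nil => rw [List.length_eq_zero_iff.1 hxy.symm]; simp
  | cons a x ih =>
    cases y with
    | nil => simp at hxy
    | cons a' y =>
      simp only [List.length_cons, Nat.add_right_cancel_iff] at hxy
      rw [sigma_iterate_cons, sigma_iterate_cons _ a', binom_append_sub_of_length_eq
        (BinomEquiv.sigma_iterate_of_length_eq (j + 1) (by simp))
        (BinomEquiv.sigma_iterate_of_length_eq (j + 1) hxy) hv, ih hxy,
        binom_sigma_iterate_sub_of_length_eq_succ (j + 1) hxy (by simp; omega),
        count_sigma_iterate_succ, count_sigma_iterate_succ]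
      simp only [List.map_cons, List.sum_cons, suffixWeight, List.length_cons, hxy]
      push_cast
      simp only [letterBinom, List.length_nil]
      push_cast
      ring

/-- Each block contains every letter m^j times. An occurrence of `b v` in one block is completed by
a `b'` in any later block, and one of `v b'` by a `b` in any earlier block. The number of earlier
blocks is a constant minus the number of later ones, whence the minus sign; terms that ignore the
order of blocks vanish for a permutation. -/
theorem binom_sigma_iterate_sub_of_perm [NeZero m] (j : ℕ) {x y v : List (ZMod m)}
    {b b' : ZMod m} (hxy : x.Perm y) (hv : v.length = j + 1) :
    (binom ((sigma m)^[j + 1] x) (b :: (v ++ [b'])) : ℤ) -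
        binom ((sigma m)^[j + 1] y) (b :: (v ++ [b'])) =
      (m : ℤ) ^ j *
        (suffixWeight (fun a => letterBinom m (j + 1) (b :: v) a -
            letterBinom m (j + 1) (v ++ [b']) a) x -
          suffixWeight (fun a => letterBinom m (j + 1) (b :: v) a -
            letterBinom m (j + 1) (v ++ [b']) a) y) := by
  rw [binom_sigma_iterate_sub j hxy.length_eq hv, (hxy.map _).sum_eq, (hxy.map _).sum_eq,
    suffixWeight_sub, suffixWeight_sub]
  ring

/-- A function on words of length `n + 1` that takes the same value on `b v` and on `v b'`,
for all letters `b`, `b'` and words `v` of length `n`, is constant. -/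
theorem eq_of_shift_invariant {A M : Type*} {n : ℕ} {f : List A → M}
    (h : ∀ b b' v, v.length = n → f (b :: v) = f (v ++ [b'])) {u w : List A}
    (hu : u.length = n + 1) (hw : w.length = n + 1) : f w = f u := by
  -- A window of length n + 1 slides along the concatenation of `w` and `u`, one letter at a time.
  have key : ∀ i ≤ n + 1, f w = f (w.drop i ++ u.take i) := by
    intro i hi
    induction i with
    | zero => simp
    | succ i ih =>
      rw [ih (by omega), List.drop_eq_getElem_cons (by omega : i < w.length), List.cons_append,
        h _ (u[i]'(by omega)) _ (by simp; omega), List.append_assoc,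
        List.take_append_getElem]
  simpa [hu, hw, ← hu] using
    (key (n + 1) le_rfl).trans (by rw [← hw, List.drop_length, hw, ← hu, List.take_length]; rfl)

/-- The coefficients obtained from `d` by applying `σ_m` and weighting positions. -/
def liftCoeff (d : ZMod m → ℤ) (b : ZMod m) : ℤ :=
  ∑ r ∈ Finset.range m, ((m : ℤ) - 1 - r) * d (b - r)

theorem sum_liftCoeff_mul [NeZero m] (d e : ZMod m → ℤ) :
    ∑ b, liftCoeff d b * e b = ∑ a, d a * suffixWeight e (sigmaLetter m a) := by
  simp only [liftCoeff, sigmaLetter_eq, suffixWeight_map_range, Finset.sum_mul, Finset.mul_sum]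
  rw [Finset.sum_comm, Finset.sum_comm (t := Finset.range m)]
  refine Finset.sum_congr rfl fun r _ => ?_
  refine Fintype.sum_equiv (Equiv.subRight (r : ZMod m)) _ _ fun b => ?_
  simp only [Equiv.subRight_apply, sub_add_cancel]
  ring

theorem sum_liftCoeff [NeZero m] (d : ZMod m → ℤ) (hd : ∑ a, d a = 0) :
    ∑ b, liftCoeff d b = 0 := by
  have := sum_liftCoeff_mul d fun _ => 1
  simp only [mul_one] at this
  rw [this, Finset.sum_congr rfl fun a _ => by
    rw [suffixWeight_const (y := sigmaLetter m 0) 1 (by simp [sigmaLetter_eq])],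
    ← Finset.sum_mul, hd, zero_mul]

/-- Moving from `b - 1` to `b` changes the weight of each `d`-value by one cyclically, except for `d
b`, whose weight jumps from 0 to m - 1. Hence `liftCoeff` is injective on coefficients of sum zero.
-/
theorem liftCoeff_sub [NeZero m] (d : ZMod m → ℤ) (b : ZMod m) :
    liftCoeff d b - liftCoeff d (b - 1) = m * d b - ∑ a, d a := by
  have h : ∑ r ∈ Finset.range m, d (b - r) = ∑ a, d a := by
    rw [sum_range_natCast fun r => d (b - r)]
    exact Fintype.sum_equiv (Equiv.subLeft b) _ _ fun _ => rfl
  rw [← h]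
  have h1 := Finset.sum_range_succ (fun r : ℕ => ((m : ℤ) - r) * d (b - r)) m
  rw [Finset.sum_range_succ'] at h1
  have h2 : liftCoeff d (b - 1) =
      ∑ r ∈ Finset.range m, ((m : ℤ) - (r + 1 : ℕ)) * d (b - (r + 1 : ℕ)) := by
    refine Finset.sum_congr rfl fun r _ => ?_
    push_cast
    rw [show b - 1 - (r : ZMod m) = b - (r + 1) by ring]
    ring
  have h3 : liftCoeff d b + ∑ r ∈ Finset.range m, d (b - r) =
      ∑ r ∈ Finset.range m, ((m : ℤ) - r) * d (b - r) := by
    rw [liftCoeff, ← Finset.sum_add_distrib]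
    exact Finset.sum_congr rfl fun r _ => by ring
  simp only [Nat.cast_zero, sub_zero, sub_self, zero_mul, add_zero] at h1
  linarith

theorem eq_zero_of_liftCoeff [NeZero m] (d : ZMod m → ℤ) (hd : ∑ a, d a = 0)
    (h : liftCoeff d = 0) : d = 0 := by
  funext b
  have := liftCoeff_sub d b
  rw [h, hd] at this
  simpa [NeZero.ne m] using this

/-- The vectors `(binom (σ_m^(j+1)(a)) w)_w`, for `w` of length `j + 2`, satisfy no affine relation
with coefficients of sum zero, even up to constants. -/
theorem eq_zero_of_sum_letterBinom_eq [NeZero m] (j : ℕ) (d : ZMod m → ℤ)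
    (hd : ∑ a, d a = 0) (c : ℤ)
    (h : ∀ w : List (ZMod m), w.length = j + 2 → ∑ a, d a * letterBinom m (j + 1) w a = c) :
    d = 0 := by
  have hm : (m : ℤ) ≠ 0 := by exact_mod_cast NeZero.ne m
  induction j generalizing d c with
  | zero =>
    -- Summing over the second letter of the pair turns pair counts in σ_m(a) into position weights.
    have h1 : ∀ b, liftCoeff d b = m * c := by
      intro b
      have h2 : ∑ b' : ZMod m, ∑ a, d a * letterBinom m 1 [b, b'] a = m * c := by
        rw [Finset.sum_congr rfl fun b' _ => h [b, b'] (by simp)]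
        simp
      rw [Finset.sum_comm] at h2
      simp only [← Finset.mul_sum, letterBinom, sum_binom_pair, Function.iterate_one,
        sigma_singleton] at h2
      rw [← h2, ← sum_liftCoeff_mul]
      simp
    have h3 := sum_liftCoeff d hd
    simp only [h1, Finset.sum_const, Finset.card_univ, ZMod.card, nsmul_eq_mul] at h3
    have hc : c = 0 := by simpa [NeZero.ne m] using h3
    exact eq_zero_of_liftCoeff d hd (by funext b; simp [h1, hc])
  | succ j ih =>
    refine eq_zero_of_liftCoeff d hd ?_
    have key : ∀ b b' v, v.length = j + 1 → (m : ℤ) ^ j *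
        (∑ a, liftCoeff d a * (letterBinom m (j + 1) (b :: v) a -
          letterBinom m (j + 1) (v ++ [b']) a)) = c := by
      intro b b' v hv
      have h1 := h (b :: (v ++ [b'])) (by simp; omega)
      rw [sum_liftCoeff_mul, ← h1, show j + 1 + 1 = j + 2 from rfl]
      -- The letter 0 is only a reference: σ_m(a) and σ_m(0) are permutations of each other, and the
      -- part independent of `a` disappears because `d` has sum zero.
      have h2 : ∀ a : ZMod m, letterBinom m (j + 2) (b :: (v ++ [b'])) a =
          letterBinom m (j + 2) (b :: (v ++ [b'])) 0 + (m : ℤ) ^ j *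
            (suffixWeight (fun a => letterBinom m (j + 1) (b :: v) a -
              letterBinom m (j + 1) (v ++ [b']) a) (sigmaLetter m a) -
            suffixWeight (fun a => letterBinom m (j + 1) (b :: v) a -
              letterBinom m (j + 1) (v ++ [b']) a) (sigmaLetter m 0)) := by
        intro a
        have := binom_sigma_iterate_sub_of_perm j (b := b) (b' := b')
          (perm_sigma_of_length_eq (x := [a]) (y := [0]) (by simp)) hv
        rw [← sigma_singleton, ← sigma_singleton, ← this]
        simp only [letterBinom, Function.iterate_succ_apply]
        ring
      have h3 : ∀ e : ℤ, ∑ a, d a * e = 0 := fun e => by rw [← Finset.sum_mul, hd, zero_mul]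
      generalize letterBinom m (j + 2) (b :: (v ++ [b'])) = L at h2 ⊢
      generalize suffixWeight (fun a => letterBinom m (j + 1) (b :: v) a -
        letterBinom m (j + 1) (v ++ [b']) a) = S at h2 ⊢
      have h4 : ∀ a, d a * L a = d a * (L 0 - (m : ℤ) ^ j * S (sigmaLetter m 0)) +
          (m : ℤ) ^ j * (d a * S (sigmaLetter m a)) := fun a => by rw [h2 a]; ring
      rw [Finset.sum_congr rfl fun a _ => h4 a, Finset.sum_add_distrib, h3, zero_add,
        Finset.mul_sum]
    -- For a constant word, `b v` and `v b'` coincide, so the left side of `key` vanishes.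
    have hc : c = 0 := by
      rw [← key 0 0 (List.replicate (j + 1) 0) (by simp), ← List.replicate_succ',
        ← List.replicate_succ]
      simp
    have key' : ∀ b b' v, v.length = j + 1 →
        ∑ a, liftCoeff d a * letterBinom m (j + 1) (b :: v) a =
          ∑ a, liftCoeff d a * letterBinom m (j + 1) (v ++ [b']) a := by
      intro b b' v hv
      have := key b b' v hv
      rw [hc, mul_eq_zero, or_iff_right (pow_ne_zero _ hm)] at this
      simpa only [mul_sub, Finset.sum_sub_distrib, sub_eq_zero] using this
    -- Shift invariance gives only constancy in `w`, which is why the induction allows an arbitrary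
    -- constant `c`.
    exact ih _ (sum_liftCoeff d hd) _ fun w hw =>
      eq_of_shift_invariant (f := fun w => ∑ a, liftCoeff d a * letterBinom m (j + 1) w a) key'
        (u := List.replicate (j + 2) 0) (by simp) hw

/-- Binomial equivalence of images under `σ_m^j` two levels up determines weighted letter counts. -/
theorem suffixWeight_eq_of_binomEquiv [NeZero m] (j : ℕ) {x y : List (ZMod m)}
    (hxy : x.Perm y) (h : BinomEquiv (j + 2) ((sigma m)^[j] x) ((sigma m)^[j] y)) (b : ZMod m) :
    suffixWeight (fun a => if a = b then 1 else 0) x =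
      suffixWeight (fun a => if a = b then 1 else 0) y := by
  have hm : (m : ℤ) ≠ 0 := by exact_mod_cast NeZero.ne m
  cases j with
  | zero =>
    rw [← sum_binom_pair, ← sum_binom_pair]
    exact Finset.sum_congr rfl fun c _ => congrArg Nat.cast (h [b, c] (by simp))
  | succ j =>
    set d : ZMod m → ℤ := fun b => suffixWeight (fun a => if a = b then 1 else 0) x -
      suffixWeight (fun a => if a = b then 1 else 0) y with hd
    have hsum : ∀ e : ZMod m → ℤ, ∑ b, d b * e b = suffixWeight e x - suffixWeight e y := by
      intro e
      rw [suffixWeight_eq_sum e x, suffixWeight_eq_sum e y, ← Finset.sum_sub_distrib]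
      exact Finset.sum_congr rfl fun b _ => by rw [hd]; ring
    have hd0 : ∑ b, d b = 0 := by
      simpa [suffixWeight_const 1 hxy.length_eq] using hsum fun _ => 1
    have key : ∀ b b' v, v.length = j + 1 →
        ∑ a, d a * letterBinom m (j + 1) (b :: v) a =
          ∑ a, d a * letterBinom m (j + 1) (v ++ [b']) a := by
      intro b b' v hv
      have := binom_sigma_iterate_sub_of_perm j (b := b) (b' := b') hxy hv
      rw [h _ (by simp; omega), sub_self, eq_comm, mul_eq_zero, or_iff_right (pow_ne_zero _ hm),
        ← hsum] at this
      simpa only [mul_sub, Finset.sum_sub_distrib, sub_eq_zero] using this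
    have := eq_zero_of_sum_letterBinom_eq j d hd0 _ fun w hw =>
      eq_of_shift_invariant (f := fun w => ∑ a, d a * letterBinom m (j + 1) w a) key
        (u := List.replicate (j + 2) 0) (by simp) hw
    exact sub_eq_zero.1 (congrFun this b)

end Letters

/-! ### Arithmetic of the generalized Thue–Morse word -/

section ThueMorse

variable {m : ℕ}

theorem getElem?_sigma (u : List (ZMod m)) (q r : ℕ) (hr : r < m) :
    (sigma m u)[m * q + r]? = u[q]?.map fun a => a + (r : ZMod m) := by
  induction u generalizing q with
  | nil => simp [sigma]
  | cons a u ih =>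
    have h : sigma m (a :: u) = sigmaLetter m a ++ sigma m u := by simp [sigma]
    have hl : (sigmaLetter m a).length = m := by simp [sigmaLetter_eq]
    rw [h]
    cases q with
    | zero =>
      rw [List.getElem?_append_left (by rw [hl]; omega)]
      simp [sigmaLetter_eq, hr]
    | succ q =>
      rw [List.getElem?_append_right (by rw [hl]; nlinarith), hl,
        show m * (q + 1) + r - m = m * q + r by rw [mul_add_one]; omega, ih]
      simp

theorem getElem?_factorAt {A : Type*} (w : ℕ → A) (i n s : ℕ) (hs : s < n) :
    (factorAt w i n)[s]? = some (w (i + s)) := by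
  simp [factorAt, hs]

theorem thueMorse_mul_add (hm : 2 ≤ m) (q r : ℕ) (hr : r < m) :
    thueMorse m (m * q + r) = thueMorse m q + r := by
  have h1 : q < m ^ q := Nat.lt_pow_self (by omega)
  have h2 : m * q + r < m ^ (q + 1) := by rw [pow_succ]; nlinarith
  have h := getElem?_sigma ((sigma m)^[q] [0]) q r hr
  rw [← Function.iterate_succ_apply' (sigma m), sigma_iterate_eq hm, sigma_iterate_eq hm,
    getElem?_factorAt _ _ _ _ h1, getElem?_factorAt _ _ _ _ h2] at h
  simpa using h

theorem thueMorse_eq (hm : 2 ≤ m) (v : ℕ) :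
    thueMorse m v = thueMorse m (v / m) + (v % m : ℕ) := by
  conv_lhs => rw [← Nat.div_add_mod v m]
  exact thueMorse_mul_add hm _ _ (Nat.mod_lt _ (by omega))

theorem thueMorse_of_dvd (hm : 2 ≤ m) {v : ℕ} (hv : m ∣ v) :
    thueMorse m v = thueMorse m (v / m) := by
  rw [thueMorse_eq hm, Nat.mod_eq_zero_of_dvd hv]; simp

theorem thueMorse_add_one_of_dvd (hm : 2 ≤ m) {v : ℕ} (hv : m ∣ v + 1) :
    thueMorse m v + 1 = thueMorse m (v / m) := by
  have h : ((v + 1 : ℕ) : ZMod m) = 0 := (ZMod.natCast_eq_zero_iff _ _).2 hv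
  rw [thueMorse_eq hm v, ZMod.natCast_mod, add_assoc]
  push_cast at h
  rw [h, add_zero]

theorem thueMorse_succ (hm : 2 ≤ m) {v : ℕ} (hv : ¬ m ∣ v + 1) :
    thueMorse m (v + 1) = thueMorse m v + 1 := by
  rw [thueMorse_eq hm (v + 1), thueMorse_eq hm v, Nat.succ_div_of_not_dvd hv, ZMod.natCast_mod,
    ZMod.natCast_mod]
  push_cast
  ring

theorem dvd_of_thueMorse_eq_succ (hm : 2 ≤ m) {v : ℕ}
    (h : thueMorse m (v + 1) = thueMorse m v) : m ∣ v + 1 := by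
  by_contra hv
  have : Fact (1 < m) := ⟨hm⟩
  rw [thueMorse_succ hm hv] at h
  exact one_ne_zero (add_eq_left.1 h)

/-- The word `t_m` contains no three equal consecutive letters. -/
theorem thueMorse_not_cube (hm : 2 ≤ m) {v : ℕ} (h : thueMorse m (v + 1) = thueMorse m v)
    (h' : thueMorse m (v + 2) = thueMorse m (v + 1)) : False := by
  have h1 := dvd_of_thueMorse_eq_succ hm h
  have h2 := dvd_of_thueMorse_eq_succ hm h'
  have := Nat.le_of_dvd one_pos ((Nat.dvd_add_right h1).1 h2)
  omega

theorem thueMorse_of_lt (hm : 2 ≤ m) {v : ℕ} (hv : v < m) : thueMorse m v = v := by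
  have := thueMorse_mul_add hm 0 v hv
  rw [mul_zero, zero_add] at this
  rw [this]
  simp [thueMorse]

/-- Every pair of letters occurs in `t_m` at any given positive distance. -/
theorem exists_thueMorse_pair (hm : 2 ≤ m) (d : ℕ) (hd : 0 < d) (a b : ZMod m) :
    ∃ q, thueMorse m q = a ∧ thueMorse m (q + d) = b := by
  have : NeZero m := ⟨by omega⟩
  have hlast : ∀ q, thueMorse m (m * q + (m - 1)) = thueMorse m q - 1 := by
    intro q
    rw [thueMorse_mul_add hm _ _ (by omega), Nat.cast_sub (by omega)]
    simp [sub_eq_add_neg]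
  have hfirst : ∀ q, thueMorse m (m * q) = thueMorse m q := fun q => by
    simpa using thueMorse_mul_add hm q 0 (by omega)
  have one : ∀ a b : ZMod m, ∃ q, thueMorse m q = a ∧ thueMorse m (q + 1) = b := by
    intro a b
    -- Passing from a pair of neighbours to the junction of their images under σ_m lowers the left
    -- letter by one and keeps the right one. The starting pair lies inside a block.
    have key : ∀ s : ℕ, ∃ q, thueMorse m q = b - 1 - s ∧ thueMorse m (q + 1) = b := by
      intro s
      induction s with
      | zero =>
        refine ⟨m * (b - 1).val, ?_, ?_⟩
        · rw [hfirst, thueMorse_of_lt hm (ZMod.val_lt _)]; simp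
        · rw [thueMorse_mul_add hm _ _ (by omega), thueMorse_of_lt hm (ZMod.val_lt _)]; simp
      | succ s ih =>
        obtain ⟨q, h1, h2⟩ := ih
        refine ⟨m * q + (m - 1), ?_, ?_⟩
        · rw [hlast, h1]; push_cast; ring
        · rw [show m * q + (m - 1) + 1 = m * (q + 1) by rw [mul_add_one]; omega, hfirst, h2]
    obtain ⟨q, h1, h2⟩ := key (b - 1 - a).val
    exact ⟨q, by rw [h1]; simp, h2⟩
  induction d using Nat.strong_induction_on generalizing a b with
  | _ d ih =>
    rcases lt_or_ge d m with h | h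
    · obtain ⟨q, h1, h2⟩ := one (a + 1) (b - (d - 1 : ℕ))
      refine ⟨m * q + (m - 1), by rw [hlast, h1]; ring, ?_⟩
      rw [show m * q + (m - 1) + d = m * (q + 1) + (d - 1) by rw [mul_add_one]; omega,
        thueMorse_mul_add hm _ _ (by omega), h2]
      ring
    · obtain ⟨q, h1, h2⟩ := ih (d / m) (Nat.div_lt_self hd (by omega))
        (Nat.div_pos h (by omega)) a (b - (d % m : ℕ))
      refine ⟨m * q, by rw [hfirst, h1], ?_⟩
      rw [show m * q + d = m * (q + d / m) + d % m by
        rw [mul_add, add_assoc, Nat.div_add_mod], thueMorse_mul_add hm _ _ (Nat.mod_lt _ (by omega)),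
        h2]
      ring

theorem factorAt_add {A : Type*} (w : ℕ → A) (i n l : ℕ) :
    factorAt w i (n + l) = factorAt w i n ++ factorAt w (i + n) l := by
  simp [factorAt, List.range_add, add_assoc]

theorem factorAt_one {A : Type*} (w : ℕ → A) (i : ℕ) : factorAt w i 1 = [w i] := by
  simp [factorAt]

theorem sigma_factorAt (hm : 2 ≤ m) (q n : ℕ) :
    sigma m (factorAt (thueMorse m) q n) = factorAt (thueMorse m) (m * q) (m * n) := by
  induction n with
  | zero => simp [factorAt, sigma]
  | succ n ih =>
    rw [factorAt_add, sigma_append, ih, mul_add_one, factorAt_add, factorAt_one, sigma_singleton,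
      sigmaLetter_eq]
    congr 1
    rw [factorAt]
    refine List.map_congr_left fun r hr => ?_
    rw [← mul_add, thueMorse_mul_add hm _ _ (List.mem_range.1 hr)]

theorem sigma_iterate_factorAt (hm : 2 ≤ m) (j q n : ℕ) :
    (sigma m)^[j] (factorAt (thueMorse m) q n) =
      factorAt (thueMorse m) (m ^ j * q) (m ^ j * n) := by
  induction j with
  | zero => simp
  | succ j ih =>
    rw [Function.iterate_succ_apply', ih, sigma_factorAt hm]
    congr 1 <;> ring

end ThueMorse

/-! ### Letter counts and position sums determine the block decomposition -/

section Alignment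

variable {m : ℕ}

/-- The total variation along `σ_m`-ascents of the factor at `p` of length `n`. -/
def ascentSum (m p n : ℕ) (h : ZMod m → ℤ) : ℤ :=
  h (thueMorse m (p + n)) - h (thueMorse m ((p + n) / m)) - h (thueMorse m p) +
    h (thueMorse m (p / m))

/-- The position-weighted analogue of `ascentSum`. -/
def weightedAscentSum (m p n : ℕ) (h : ZMod m → ℤ) : ℤ :=
  m * ∑ q ∈ Finset.Ico (p / m) ((p + n) / m), h (thueMorse m q) + n * h (thueMorse m (p + n)) -
    ((m : ℤ) * ((p + n) / m : ℕ) - p) * h (thueMorse m ((p + n) / m)) -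
    (p % m : ℕ) * h (thueMorse m (p / m))

/-- Inside a block the next letter is the current one plus 1, so the sum telescopes; a complete
block runs once around the alphabet and contributes 0. Only the two ends remain. -/
theorem sum_eq_ascentSum (hm : 2 ≤ m) (p n : ℕ) (h : ZMod m → ℤ) :
    ∑ s ∈ Finset.range n, (h (thueMorse m (p + s) + 1) - h (thueMorse m (p + s))) =
      ascentSum m p n h := by
  induction n with
  | zero => simp [ascentSum]
  | succ n ih =>
    rw [Finset.sum_range_succ, ih, ascentSum, ascentSum, ← add_assoc]
    by_cases hd : m ∣ p + n + 1
    · rw [thueMorse_add_one_of_dvd hm hd, thueMorse_of_dvd hm hd]; ring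
    · rw [thueMorse_succ hm hd, Nat.succ_div_of_not_dvd hd]; ring

/-- The same telescoping, except that a complete block with first letter c now contributes m · h(c).
This gives access to the letters indexing the blocks. -/
theorem sum_eq_weightedAscentSum (hm : 2 ≤ m) (p n : ℕ) (h : ZMod m → ℤ) :
    ∑ s ∈ Finset.range n,
      (((s : ℤ) + 1) * h (thueMorse m (p + s) + 1) - s * h (thueMorse m (p + s))) =
      weightedAscentSum m p n h := by
  induction n with
  | zero =>
    have : (p : ℤ) = m * (p / m : ℕ) + (p % m : ℕ) := by exact_mod_cast (Nat.div_add_mod p m).symm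
    simp only [weightedAscentSum, Finset.range_zero, Finset.sum_empty, add_zero, Finset.Ico_self]
    push_cast at this ⊢
    linear_combination -h (thueMorse m (p / m)) * this
  | succ n ih =>
    rw [Finset.sum_range_succ, ih, weightedAscentSum, weightedAscentSum, ← add_assoc]
    by_cases hd : m ∣ p + n + 1
    · have h1 : (m : ℤ) * ((p + n) / m + 1 : ℕ) = p + n + 1 := by
        rw [← Nat.succ_div_of_dvd hd]
        exact_mod_cast Nat.mul_div_cancel' hd
      rw [thueMorse_add_one_of_dvd hm hd, thueMorse_of_dvd hm hd, Nat.succ_div_of_dvd hd,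
        Finset.sum_Ico_succ_top (Nat.div_le_div_right (Nat.le_add_right p n)), h1]
      push_cast at h1 ⊢
      linear_combination -h (thueMorse m ((p + n) / m)) * h1
    · rw [thueMorse_succ hm hd, Nat.succ_div_of_not_dvd hd]
      push_cast
      ring

theorem natCast_ne_zero_of_lt {i : ℕ} (h : i < m) (h0 : i ≠ 0) : (i : ZMod m) ≠ 0 := by
  rw [Ne, ZMod.natCast_eq_zero_iff]
  exact fun hd => h0 (Nat.eq_zero_of_dvd_of_lt hd h)

theorem natCast_inj_of_lt {i j : ℕ} (hi : i < m) (hj : j < m) (h : (i : ZMod m) = j) : i = j := by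
  rw [ZMod.natCast_eq_natCast_iff'] at h
  rwa [Nat.mod_eq_of_lt hi, Nat.mod_eq_of_lt hj] at h

theorem weightedAscentSum_cast (p n : ℕ) (h : ZMod m → ℤ) :
    ((weightedAscentSum m p n h : ℤ) : ZMod m) = n * h (thueMorse m (p + n)) +
      p * h (thueMorse m ((p + n) / m)) - p * h (thueMorse m (p / m)) := by
  rw [weightedAscentSum]
  push_cast
  simp only [CharP.cast_eq_zero]
  ring

/-- If the partial blocks at the two ends of a factor are not consecutive, then the ascent sums
determine the position modulo `m`. -/
theorem mod_eq_of_not_chained (hm : 2 ≤ m) {p p' n : ℕ}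
    (hpsi : ∀ h, ascentSum m p n h = ascentSum m p' n h)
    (hphi : ∀ h, weightedAscentSum m p n h = weightedAscentSum m p' n h)
    (hp : p % m ≠ 0) (hj : (p + n) % m ≠ 0)
    (hcb : thueMorse m (p / m) ≠ thueMorse m ((p + n) / m)) : p % m = p' % m := by
  have hm0 : 0 < m := by omega
  have hl := thueMorse_eq hm (p + n)
  have hl' := thueMorse_eq hm (p' + n)
  -- Testing on the letter `b` of the right end block makes the ascent sum at `p` negative, and the
  -- weighted one congruent to `p` modulo m. The possibilities at `p'` are then enumerated.
  have h1 := hpsi fun z => if z = thueMorse m ((p + n) / m) then 1 else 0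
  have h2 := congrArg (Int.cast : ℤ → ZMod m)
    (hphi fun z => if z = thueMorse m ((p + n) / m) then 1 else 0)
  rw [weightedAscentSum_cast, weightedAscentSum_cast] at h2
  simp only [ascentSum] at h1
  set b := thueMorse m ((p + n) / m) with hb
  have hlb : thueMorse m (p + n) ≠ b := by
    rw [hl]; simpa using natCast_ne_zero_of_lt (Nat.mod_lt _ hm0) hj
  simp only [hlb, hcb, if_true, if_false] at h1 h2
  have hp0 : (p : ZMod m) ≠ 0 := by
    rw [← ZMod.natCast_mod]; exact natCast_ne_zero_of_lt (Nat.mod_lt _ hm0) hp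
  suffices h : (p : ZMod m) = 0 ∨ (p : ZMod m) = p' by
    rcases h with h | h
    · exact absurd h hp0
    · exact (ZMod.natCast_eq_natCast_iff' _ _ _).1 h
  simp only [Int.cast_zero, Int.cast_one, mul_zero, mul_one, zero_add, sub_zero] at h2
  by_cases e1 : thueMorse m (p' + n) = b <;> by_cases e2 : thueMorse m ((p' + n) / m) = b <;>
    by_cases e3 : thueMorse m (p' / m) = b <;> by_cases e4 : thueMorse m p' = b <;>
    simp only [e1, e2, e3, e4, if_true, if_false, Int.cast_zero, Int.cast_one, mul_zero, mul_one,
      zero_add, sub_zero, add_zero, sub_self] at h1 h2 <;>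
    first
    | (exfalso; split_ifs at h1 <;> omega)
    | exact Or.inl h2
    | exact Or.inr h2
    | skip
  -- The surviving case: the letter at `p' + n` equals its block letter, so m divides `p' + n`.
  · left
    rw [h2, ← Nat.cast_add, add_comm n p', ← ZMod.natCast_mod]
    rw [e1, e2] at hl'
    simpa using hl'

theorem forall_of_card_le_sum {ι : Type*} {S : Finset ι} {f : ι → ZMod m} {z : ZMod m}
    (h : (S.card : ℤ) ≤ ∑ q ∈ S, if f q = z then 1 else 0) : ∀ q ∈ S, f q = z := by
  by_contra! hne
  obtain ⟨q, hq, hz⟩ := hne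
  refine h.not_gt ?_
  rw [Finset.card_eq_sum_ones]
  push_cast
  exact Finset.sum_lt_sum (fun i _ => by split_ifs <;> simp) ⟨q, hq, by simp [hz]⟩

theorem sum_ite_nonneg {ι : Type*} (S : Finset ι) (f : ι → ZMod m) (z : ZMod m) :
    (0 : ℤ) ≤ ∑ q ∈ S, if f q = z then 1 else 0 :=
  Finset.sum_nonneg fun i _ => by split_ifs <;> simp

theorem sum_ite_eq_zero_of_forall {ι : Type*} {S : Finset ι} {f : ι → ZMod m} {z z' : ZMod m}
    (h : ∀ q ∈ S, f q = z) (hz : z ≠ z') : (∑ q ∈ S, if f q = z' then (1 : ℤ) else 0) = 0 :=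
  Finset.sum_eq_zero fun q hq => by rw [h q hq, if_neg hz]

theorem eq_div_sub_div_mul (p n : ℕ) :
    (n : ℤ) = m * (((p + n) / m : ℕ) - (p / m : ℕ)) - (p % m : ℕ) + ((p + n) % m : ℕ) := by
  have h1 : (p : ℤ) = m * (p / m : ℕ) + (p % m : ℕ) := by exact_mod_cast (Nat.div_add_mod p m).symm
  have h2 : (p : ℤ) + n = m * ((p + n) / m : ℕ) + ((p + n) % m : ℕ) := by
    exact_mod_cast (Nat.div_add_mod (p + n) m).symm
  linarith

/-- Otherwise t_m would contain a cube of a letter. If the range has only two elements, then `p + n`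
is not a multiple of m, and `hch` supplies the third equal letter. -/
theorem not_forall_thueMorse_eq (hm : 2 ≤ m) {p n : ℕ} (hn : 2 * m ≤ n)
    (hch : p % m = 0 ∨ (p + n) % m = 0 ∨ thueMorse m (p / m) = thueMorse m ((p + n) / m))
    (hp : p % m ≠ 0) (z : ZMod m) :
    ¬ ∀ q ∈ Finset.Ico (p / m) ((p + n) / m), thueMorse m q = z := by
  intro hz
  have h1 := Nat.div_add_mod p m
  have h2 := Nat.div_add_mod (p + n) m
  have hj : (p + n) % m < m := Nat.mod_lt _ (by omega)
  have hR : p / m + 2 ≤ (p + n) / m := by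
    rw [← Nat.add_mul_div_right p 2 (by omega : 0 < m)]
    exact Nat.div_le_div_right (by omega)
  have e0 := hz (p / m) (by simp; omega)
  have e1 := hz (p / m + 1) (by simp; omega)
  refine thueMorse_not_cube hm (e1.trans e0.symm) (Eq.trans ?_ e1.symm)
  rcases hR.eq_or_lt with hR | hR
  · rw [← hR] at h2 hch
    have : (p + n) % m ≠ 0 := by rw [mul_add] at h2; omega
    exact ((hch.resolve_left hp).resolve_left this).symm.trans e0
  · exact hz _ (by simp; omega)

/-- In the situation excluded by `mod_eq_of_not_chained`, the end contributions merge: the ends can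
be treated as lying in blocks with a common letter `b`, since an end at a block boundary may be
given either letter at no cost. -/
theorem exists_chain (hm : 2 ≤ m) {p n : ℕ}
    (hch : p % m = 0 ∨ (p + n) % m = 0 ∨ thueMorse m (p / m) = thueMorse m ((p + n) / m)) :
    ∃ b : ZMod m,
      (∀ h, ascentSum m p n h = h (b + ((p + n) % m : ℕ)) - h (b + (p % m : ℕ))) ∧
      (∀ h, weightedAscentSum m p n h =
        m * (∑ q ∈ Finset.Ico (p / m) ((p + n) / m), h (thueMorse m q) -
          (((p + n) / m : ℕ) - (p / m : ℕ)) * h b) + n * h (b + ((p + n) % m : ℕ))) := by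
  have hl := thueMorse_eq hm (p + n)
  have hf := thueMorse_eq hm p
  have hn := eq_div_sub_div_mul (m := m) p n
  have h1 : (p : ℤ) = m * (p / m : ℕ) + (p % m : ℕ) := by exact_mod_cast (Nat.div_add_mod p m).symm
  by_cases hp : p % m = 0
  · refine ⟨thueMorse m ((p + n) / m), fun h => ?_, fun h => ?_⟩
    · rw [hp, Nat.cast_zero, add_zero] at hf
      rw [ascentSum, ← hl, hf, hp, Nat.cast_zero, add_zero]; ring
    · rw [weightedAscentSum, ← hl, hp]
      rw [hp] at h1
      push_cast at h1 ⊢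
      linear_combination h (thueMorse m ((p + n) / m)) * h1
  by_cases hj : (p + n) % m = 0
  · refine ⟨thueMorse m (p / m), fun h => ?_, fun h => ?_⟩
    · rw [hj, Nat.cast_zero, add_zero] at hl ⊢
      rw [ascentSum, ← hf, hl]; ring
    · rw [hj, Nat.cast_zero, add_zero] at hl hn ⊢
      rw [weightedAscentSum, hl]
      push_cast at hn h1 ⊢
      linear_combination (h (thueMorse m ((p + n) / m)) - h (thueMorse m (p / m))) * hn +
        h (thueMorse m ((p + n) / m)) * h1
  · have hcb := (hch.resolve_left hp).resolve_left hj
    refine ⟨thueMorse m (p / m), fun h => ?_, fun h => ?_⟩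
    · rw [ascentSum, ← hf, hcb, ← hl]; ring
    · rw [weightedAscentSum, hcb, ← hl]
      push_cast at h1 ⊢
      linear_combination h (thueMorse m ((p + n) / m)) * h1

theorem mod_eq_of_ascentSum_eq_of_ne_zero (hm : 2 ≤ m) {p p' n : ℕ} (hn : 2 * m ≤ n)
    (hpsi : ∀ h, ascentSum m p n h = ascentSum m p' n h)
    (hphi : ∀ h, weightedAscentSum m p n h = weightedAscentSum m p' n h)
    (hp' : p' % m ≠ 0) : p % m = p' % m := by
  by_contra hne
  have hm0 : 0 < m := by omega
  have hmz : (m : ℤ) ≠ 0 := by omega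
  have hx : p % m = 0 ∨ (p + n) % m = 0 ∨
      thueMorse m (p / m) = thueMorse m ((p + n) / m) := by
    by_contra! hc
    exact hne (mod_eq_of_not_chained hm hpsi hphi hc.1 hc.2.1 hc.2.2)
  have hy : p' % m = 0 ∨ (p' + n) % m = 0 ∨
      thueMorse m (p' / m) = thueMorse m ((p' + n) / m) := by
    by_contra! hc
    exact hne (mod_eq_of_not_chained hm (fun h => (hpsi h).symm) (fun h => (hphi h).symm)
      hc.1 hc.2.1 hc.2.2).symm
  obtain ⟨b, h1, h2⟩ := exists_chain hm (n := n) hx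
  obtain ⟨b', h1', h2'⟩ := exists_chain hm (n := n) hy
  have hcard := not_forall_thueMorse_eq hm hn hx
  have hcard' := not_forall_thueMorse_eq hm hn hy hp'
  have hR : ((Finset.Ico (p / m) ((p + n) / m)).card : ℤ) = ((p + n) / m : ℕ) - (p / m : ℕ) := by
    rw [Nat.card_Ico, Nat.cast_sub (Nat.div_le_div_right (Nat.le_add_right p n))]
  have hR' : ((Finset.Ico (p' / m) ((p' + n) / m)).card : ℤ) =
      ((p' + n) / m : ℕ) - (p' / m : ℕ) := by
    rw [Nat.card_Ico, Nat.cast_sub (Nat.div_le_div_right (Nat.le_add_right p' n))]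
  have hlen := eq_div_sub_div_mul (m := m) p n
  have hlen' := eq_div_sub_div_mul (m := m) p' n
  rw [← hR] at hlen
  rw [← hR'] at hlen'
  simp only [h1, h1'] at hpsi
  simp only [h2, h2', ← hR, ← hR'] at hphi
  have hi : p % m < m := Nat.mod_lt _ hm0
  have hi' : p' % m < m := Nat.mod_lt _ hm0
  have hj : (p + n) % m < m := Nat.mod_lt _ hm0
  have hj' : (p' + n) % m < m := Nat.mod_lt _ hm0
  clear h1 h2 h1' h2' hx hy hR hR'
  set X := Finset.Ico (p / m) ((p + n) / m)
  set Y := Finset.Ico (p' / m) ((p' + n) / m)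
  set i := p % m
  set i' := p' % m
  set j := (p + n) % m
  set j' := (p' + n) % m
  have hbi' : b' + (i' : ZMod m) ≠ b' := by simpa using natCast_ne_zero_of_lt hi' hp'
  -- The ascent sums are differences of two point masses. Either both masses agree, or both
  -- differences vanish. In each case well-chosen indicators force all the blocks in a range to be
  -- equal, against `not_forall_thueMorse_eq`.
  by_cases hl : b + (j : ZMod m) = b' + (j' : ZMod m)
  · have hf : b + (i : ZMod m) = b' + (i' : ZMod m) := by
      have := hpsi fun z => if z = b + (i : ZMod m) then 1 else 0
      simp only [hl, if_true] at this
      by_contra hf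
      rw [if_neg (Ne.symm hf)] at this
      omega
    have hb : b ≠ b' := by
      rintro rfl
      exact hne (natCast_inj_of_lt hi hi' (add_left_cancel hf))
    have := hphi fun z => if z = b' then 1 else 0
    simp only [hl, hb, if_true, if_false, mul_zero, mul_one, sub_zero] at this
    have h3 := mul_left_cancel₀ hmz (add_right_cancel this)
    have h4 := sum_ite_nonneg X (thueMorse m) b'
    exact hcard' b' (forall_of_card_le_sum (by linarith))
  · have hf' : b' + (i' : ZMod m) = b' + (j' : ZMod m) := by
      have := hpsi fun z => if z = b' + (j' : ZMod m) then 1 else 0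
      simp only [hl, if_true, if_false] at this
      by_contra hf
      rw [if_neg hf] at this
      split_ifs at this <;> omega
    have hf : b + (i : ZMod m) = b + (j : ZMod m) := by
      have := hpsi fun z => if z = b + (j : ZMod m) then 1 else 0
      simp only [Ne.symm hl, if_true, if_false] at this
      by_contra hf
      rw [if_neg hf] at this
      split_ifs at this <;> omega
    have hij : i = j := natCast_inj_of_lt hi hj (add_left_cancel hf)
    have hij' : i' = j' := natCast_inj_of_lt hi' hj' (add_left_cancel hf')
    rw [← hij] at hlen
    rw [← hij'] at hlen'
    rw [sub_add_cancel] at hlen hlen'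
    have hRR : (X.card : ℤ) = Y.card := mul_left_cancel₀ hmz (hlen.symm.trans hlen')
    have hphi' : ∀ h : ZMod m → ℤ,
        ∑ q ∈ X, h (thueMorse m q) - X.card * h b + X.card * h (b + (i : ZMod m)) =
        ∑ q ∈ Y, h (thueMorse m q) - X.card * h b' + X.card * h (b' + (i' : ZMod m)) := by
      intro h
      refine mul_left_cancel₀ hmz ?_
      have := hphi h
      rw [← hf, ← hf', hlen, ← hRR] at this
      linear_combination this
    rw [← hf, ← hf'] at hl
    have hX : ∀ q ∈ X, thueMorse m q = b' + (i' : ZMod m) := by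
      refine forall_of_card_le_sum ?_
      have := hphi' fun z => if z = b' + (i' : ZMod m) then 1 else 0
      simp only [hl, Ne.symm hbi', if_true, if_false, mul_zero, mul_one, sub_zero, add_zero]
        at this
      have h4 := sum_ite_nonneg Y (thueMorse m) (b' + (i' : ZMod m))
      split_ifs at this <;> linarith
    have hi0 : i = 0 := by
      by_contra hi0
      exact hcard hi0 _ hX
    refine hcard' b' (forall_of_card_le_sum ?_)
    have := hphi' fun z => if z = b' then 1 else 0
    rw [hi0, sum_ite_eq_zero_of_forall hX hbi'] at this
    simp only [hbi', if_true, if_false, mul_zero, mul_one, add_zero, Nat.cast_zero] at this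
    linarith

theorem mod_eq_of_ascentSum_eq (hm : 2 ≤ m) {p p' n : ℕ} (hn : 2 * m ≤ n)
    (hpsi : ∀ h, ascentSum m p n h = ascentSum m p' n h)
    (hphi : ∀ h, weightedAscentSum m p n h = weightedAscentSum m p' n h) : p % m = p' % m := by
  by_cases hp' : p' % m = 0
  · by_cases hp : p % m = 0
    · rw [hp, hp']
    · exact (mod_eq_of_ascentSum_eq_of_ne_zero hm hn (fun h => (hpsi h).symm)
        (fun h => (hphi h).symm) hp).symm
  · exact mod_eq_of_ascentSum_eq_of_ne_zero hm hn hpsi hphi hp'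

/-- The number of occurrences of the letter `a` in the prefix of length `v` of `t_m`. -/
def prefixCount (m : ℕ) (a : ZMod m) (v : ℕ) : ℤ :=
  ∑ s ∈ Finset.range v, if thueMorse m s = a then 1 else 0

theorem prefixCount_add (a : ZMod m) (p n : ℕ) :
    prefixCount m a (p + n) = prefixCount m a p +
      ∑ s ∈ Finset.range n, if thueMorse m (p + s) = a then 1 else 0 := by
  rw [prefixCount, prefixCount, Finset.sum_range_add]

theorem sum_range_ite_eq [NeZero m] (a c : ZMod m) :
    (∑ r ∈ Finset.range m, if c + (r : ZMod m) = a then (1 : ℤ) else 0) = 1 := by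
  rw [sum_range_add_natCast fun z => if z = a then (1 : ℤ) else 0]
  simp

/-- The number of occurrences of `z` in the prefix of length `n` of the image of `c` under `σ_m`. -/
def blockPrefixCount (c z : ZMod m) (n : ℕ) : ℤ :=
  ∑ r ∈ Finset.range n, if c + (r : ZMod m) = z then 1 else 0

theorem prefixCount_eq (hm : 2 ≤ m) (a : ZMod m) (v : ℕ) :
    prefixCount m a v = (v / m : ℕ) +
      blockPrefixCount (thueMorse m (v / m)) a (v % m) := by
  have : NeZero m := ⟨by omega⟩
  have h : ∀ q, prefixCount m a (m * q) = q := by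
    intro q
    induction q with
    | zero => simp [prefixCount]
    | succ q ih =>
      rw [mul_add_one, prefixCount_add, ih, Finset.sum_congr rfl fun r hr => by
        rw [thueMorse_mul_add hm _ _ (Finset.mem_range.1 hr)], sum_range_ite_eq]
      push_cast
      rfl
  conv_lhs => rw [← Nat.div_add_mod v m]
  rw [prefixCount_add, h]
  congr 1
  refine Finset.sum_congr rfl fun r hr => ?_
  rw [thueMorse_mul_add hm _ _
    ((Finset.mem_range.1 hr).trans (Nat.mod_lt _ (by omega)))]

theorem prefixCount_bounds (hm : 2 ≤ m) (a : ZMod m) (v : ℕ) :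
    0 ≤ prefixCount m a v - (v / m : ℕ) ∧ prefixCount m a v - (v / m : ℕ) ≤ 1 := by
  have : NeZero m := ⟨by omega⟩
  rw [prefixCount_eq hm, add_sub_cancel_left, blockPrefixCount]
  refine ⟨Finset.sum_nonneg fun _ _ => by split_ifs <;> simp, ?_⟩
  refine le_of_le_of_eq (Finset.sum_le_sum_of_subset_of_nonneg
    (Finset.range_subset_range.2 (Nat.mod_lt v (by omega)).le)
    fun _ _ _ => by split_ifs <;> simp) (sum_range_ite_eq a (thueMorse m (v / m)))

theorem prefixCount_of_dvd (hm : 2 ≤ m) (a : ZMod m) {v : ℕ} (hv : m ∣ v) :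
    prefixCount m a v = (v / m : ℕ) := by
  rw [prefixCount_eq hm, Nat.mod_eq_zero_of_dvd hv]; simp [blockPrefixCount]

/-- This is `sum_eq_ascentSum` from position 0, where the left end contributes nothing. -/
theorem prefixCount_sub (hm : 2 ≤ m) (a : ZMod m) (v : ℕ) :
    prefixCount m (a - 1) v - prefixCount m a v =
      (if thueMorse m v = a then 1 else 0) - if thueMorse m (v / m) = a then 1 else 0 := by
  have := sum_eq_ascentSum hm 0 v fun z => if z = a then 1 else 0
  rw [ascentSum, Finset.sum_sub_distrib] at this
  simp only [zero_add, Nat.zero_div, sub_add_cancel] at this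
  rw [← this, prefixCount, prefixCount]
  simp only [eq_sub_iff_add_eq]

/-- By `prefixCount_sub`, the first letter of a partial block is recognised as the place where the
counts of consecutive letters differ by -1. -/
theorem thueMorse_div_eq_of_prefixCount (hm : 2 ≤ m) {v v' : ℕ} (hv : v % m ≠ 0)
    (h : ∀ a, prefixCount m a v - (v / m : ℕ) = prefixCount m a v' - (v' / m : ℕ)) :
    thueMorse m (v / m) = thueMorse m (v' / m) := by
  have h1 := prefixCount_sub hm (thueMorse m (v / m)) v
  have h2 := prefixCount_sub hm (thueMorse m (v / m)) v'
  have h3 := h (thueMorse m (v / m))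
  have h4 := h (thueMorse m (v / m) - 1)
  have h5 : thueMorse m v ≠ thueMorse m (v / m) := by
    rw [thueMorse_eq hm v]
    simpa using natCast_ne_zero_of_lt (Nat.mod_lt _ (by omega)) hv
  rw [if_neg h5, if_pos rfl] at h1
  by_contra hne
  rw [if_neg (Ne.symm hne)] at h2
  split_ifs at h2 <;> omega

theorem sum_prefixCount_sub (a : ZMod m) (p n : ℕ) :
    ∑ s ∈ Finset.range n, (prefixCount m a (p + s) - prefixCount m a p) =
      ∑ s ∈ Finset.range n, ((n : ℤ) - 1 - s) * if thueMorse m (p + s) = a then 1 else 0 := by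
  induction n with
  | zero => simp
  | succ n ih =>
    rw [Finset.sum_range_succ, ih, Finset.sum_range_succ, prefixCount_add, add_sub_cancel_left,
      ← Finset.sum_add_distrib]
    push_cast
    rw [add_sub_cancel_right, sub_self, zero_mul, add_zero]
    exact Finset.sum_congr rfl fun s _ => by ring

theorem add_div_sub_div (p s : ℕ) (hm : 0 < m) :
    (((p + s) / m : ℕ) : ℤ) - (p / m : ℕ) = ((p % m + s) / m : ℕ) := by
  have : (p + s) / m = p / m + (p % m + s) / m := by
    conv_lhs => rw [← Nat.div_add_mod p m, add_assoc, Nat.mul_add_div hm]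
  rw [this]; push_cast; ring

/-- The excess of a prefix count over the number of complete blocks is 0 or 1. If it were 0 at `p`
and 1 at `p'`, then, counting from the start, the factor at `p` would never lag behind the one at
`p'` and would be strictly ahead somewhere, so the position sums, rewritten by
`sum_prefixCount_sub`, would differ. -/
theorem prefixCount_sub_div_le (hm : 2 ≤ m) {p p' n : ℕ} (hn : 2 * m ≤ n)
    (hpp : p % m = p' % m) (a : ZMod m)
    (h2 : ∑ s ∈ Finset.range n, ((n : ℤ) - 1 - s) * (if thueMorse m (p + s) = a then 1 else 0) =
      ∑ s ∈ Finset.range n, ((n : ℤ) - 1 - s) * if thueMorse m (p' + s) = a then 1 else 0) :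
    prefixCount m a p' - (p' / m : ℕ) ≤ prefixCount m a p - (p / m : ℕ) := by
  by_contra! hlt
  rw [← sum_prefixCount_sub, ← sum_prefixCount_sub] at h2
  refine h2.not_gt ?_
  have hm0 : 0 < m := by omega
  have b1 := prefixCount_bounds hm a p
  have b2 := prefixCount_bounds hm a p'
  -- Strictness occurs at the first block boundary after the start, where both excesses are 0.
  refine Finset.sum_lt_sum (fun s _ => ?_) ⟨m - p % m, ?_, ?_⟩
  · have b3 := prefixCount_bounds hm a (p + s)
    have b4 := prefixCount_bounds hm a (p' + s)
    have e1 := add_div_sub_div p s hm0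
    have e2 := add_div_sub_div p' s hm0
    rw [hpp] at e1
    omega
  · simp; omega
  · have hd : ∀ {x : ℕ}, x % m = p % m → m ∣ x + (m - p % m) := by
      intro x hx
      refine ⟨x / m + 1, ?_⟩
      have := Nat.div_add_mod x m
      have := Nat.mod_lt p hm0
      rw [mul_add_one]; omega
    have b3 := prefixCount_of_dvd hm a (hd rfl)
    have b4 := prefixCount_of_dvd hm a (hd hpp.symm)
    have e1 := add_div_sub_div p (m - p % m) hm0
    have e2 := add_div_sub_div p' (m - p % m) hm0
    rw [← hpp] at e2
    omega

/-- Two sufficiently long factors of `t_m` in which every letter has the same number of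
occurrences and the same sum of positions have the same decomposition into blocks, up to a
permutation of the blocks. -/
theorem alignment_of_weights_eq (hm : 2 ≤ m) {p p' n : ℕ} (hn : 2 * m ≤ n)
    (hS1 : ∀ h : ZMod m → ℤ, ∑ s ∈ Finset.range n, h (thueMorse m (p + s)) =
      ∑ s ∈ Finset.range n, h (thueMorse m (p' + s)))
    (hS2 : ∀ h : ZMod m → ℤ,
      ∑ s ∈ Finset.range n, ((n : ℤ) - 1 - s) * h (thueMorse m (p + s)) =
      ∑ s ∈ Finset.range n, ((n : ℤ) - 1 - s) * h (thueMorse m (p' + s))) :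
    p % m = p' % m ∧ (p % m ≠ 0 → thueMorse m (p / m) = thueMorse m (p' / m)) ∧
    ((p + n) % m ≠ 0 → thueMorse m ((p + n) / m) = thueMorse m ((p' + n) / m)) ∧
    ∀ h : ZMod m → ℤ, ∑ q ∈ Finset.Ico (p / m) ((p + n) / m), h (thueMorse m q) =
      ∑ q ∈ Finset.Ico (p' / m) ((p' + n) / m), h (thueMorse m q) := by
  have hm0 : 0 < m := by omega
  have hmz : (m : ℤ) ≠ 0 := by omega
  have hpsi : ∀ h, ascentSum m p n h = ascentSum m p' n h := by
    intro h
    rw [← sum_eq_ascentSum hm, ← sum_eq_ascentSum hm]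
    exact hS1 fun z => h (z + 1) - h z
  have hphi : ∀ h, weightedAscentSum m p n h = weightedAscentSum m p' n h := by
    intro h
    rw [← sum_eq_weightedAscentSum hm, ← sum_eq_weightedAscentSum hm]
    have e : ∀ p, ∑ s ∈ Finset.range n,
        (((s : ℤ) + 1) * h (thueMorse m (p + s) + 1) - s * h (thueMorse m (p + s))) =
        ∑ s ∈ Finset.range n, ((fun z => (n : ℤ) * h (z + 1) - ((n : ℤ) - 1) * h z)
            (thueMorse m (p + s))) -
          ∑ s ∈ Finset.range n, ((n : ℤ) - 1 - s) *
            ((fun z => h (z + 1) - h z) (thueMorse m (p + s))) := by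
      intro p
      rw [← Finset.sum_sub_distrib]
      exact Finset.sum_congr rfl fun s _ => by ring
    rw [e, e, hS1 fun z => (n : ℤ) * h (z + 1) - ((n : ℤ) - 1) * h z,
      hS2 fun z => h (z + 1) - h z]
  have hpp := mod_eq_of_ascentSum_eq hm hn hpsi hphi
  have hcp : ∀ a, prefixCount m a p - (p / m : ℕ) = prefixCount m a p' - (p' / m : ℕ) :=
    fun a => le_antisymm (prefixCount_sub_div_le hm hn hpp.symm a (hS2 fun z => if z = a then 1 else 0).symm)
      (prefixCount_sub_div_le hm hn hpp a (hS2 fun z => if z = a then 1 else 0))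
  have hR : (((p + n) / m : ℕ) : ℤ) - (p / m : ℕ) = ((p' + n) / m : ℕ) - (p' / m : ℕ) := by
    rw [add_div_sub_div p n hm0, add_div_sub_div p' n hm0, hpp]
  have hjj : (p + n) % m = (p' + n) % m := by rw [Nat.add_mod, hpp, ← Nat.add_mod]
  have hcq : ∀ a, prefixCount m a (p + n) - ((p + n) / m : ℕ) =
      prefixCount m a (p' + n) - ((p' + n) / m : ℕ) := by
    intro a
    have h1 := hcp a
    rw [prefixCount_add, prefixCount_add, hS1 fun z => if z = a then 1 else 0]
    linarith
  have hc : p % m ≠ 0 → thueMorse m (p / m) = thueMorse m (p' / m) :=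
    fun h => thueMorse_div_eq_of_prefixCount hm h hcp
  have hb : (p + n) % m ≠ 0 → thueMorse m ((p + n) / m) = thueMorse m ((p' + n) / m) :=
    fun h => thueMorse_div_eq_of_prefixCount hm h hcq
  refine ⟨hpp, hc, hb, fun h => mul_left_cancel₀ hmz ?_⟩
  have h1 := hphi h
  have hlen := eq_div_sub_div_mul (m := m) p n
  have e1 : (p : ℤ) = m * (p / m : ℕ) + (p % m : ℕ) := by exact_mod_cast (Nat.div_add_mod p m).symm
  have e2 : (p' : ℤ) = m * (p' / m : ℕ) + (p' % m : ℕ) := by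
    exact_mod_cast (Nat.div_add_mod p' m).symm
  have e3 : (m : ℤ) * ((p' + n) / m : ℕ) - p' = m * ((p + n) / m : ℕ) - p := by
    rw [e1, e2, ← hpp]; linear_combination -(m : ℤ) * hR
  have k1 : ((p % m : ℕ) : ℤ) * h (thueMorse m (p / m)) =
      (p % m : ℕ) * h (thueMorse m (p' / m)) := by
    by_cases h0 : p % m = 0
    · rw [h0]; simp
    · rw [hc h0]
  -- If `p + n` is a multiple of m, the two coefficients are equal and so are the two letters, so
  -- each side is 0; otherwise the end blocks are already known to agree.
  have k2 : (n : ℤ) * h (thueMorse m (p + n)) -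
        ((m : ℤ) * ((p + n) / m : ℕ) - p) * h (thueMorse m ((p + n) / m)) =
      (n : ℤ) * h (thueMorse m (p' + n)) -
        ((m : ℤ) * ((p + n) / m : ℕ) - p) * h (thueMorse m ((p' + n) / m)) := by
    by_cases h0 : (p + n) % m = 0
    · have : (n : ℤ) = (m : ℤ) * ((p + n) / m : ℕ) - p := by
        rw [h0] at hlen; push_cast at hlen e1 ⊢; linarith
      rw [← this, thueMorse_of_dvd hm (Nat.dvd_of_mod_eq_zero h0),
        thueMorse_of_dvd hm (Nat.dvd_of_mod_eq_zero (hjj.symm.trans h0))]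
      ring
    · rw [thueMorse_eq hm (p + n), thueMorse_eq hm (p' + n), hb h0, hjj]
  rw [weightedAscentSum, weightedAscentSum, e3, ← hpp] at h1
  linarith

end Alignment

/-! ### Equivalence as alignment, and counting the classes -/

section Characterization

variable {m : ℕ}

/-- The factors of length `n` at `p` and `p'` have the same decomposition into blocks of length `B`,
up to a permutation of the blocks. -/
def Aligned (m B n p p' : ℕ) : Prop :=
  p % B = p' % B ∧ (p % B ≠ 0 → thueMorse m (p / B) = thueMorse m (p' / B)) ∧
  ((p + n) % B ≠ 0 → thueMorse m ((p + n) / B) = thueMorse m ((p' + n) / B)) ∧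
  ∀ a, prefixCount m a ((p + n) / B) - prefixCount m a (p / B) =
    prefixCount m a ((p' + n) / B) - prefixCount m a (p' / B)

theorem count_factorAt (a : ZMod m) (q N : ℕ) :
    ((factorAt (thueMorse m) q N).count a : ℤ) =
      prefixCount m a (q + N) - prefixCount m a q := by
  induction N with
  | zero => simp [factorAt]
  | succ N ih =>
    rw [factorAt_add, List.count_append, Nat.cast_add, ih, factorAt_one, ← add_assoc,
      prefixCount_add a (q + N) 1]
    simp only [Finset.range_one, Finset.sum_singleton, add_zero, List.count_singleton]
    simp
    ring

theorem factorAt_perm_iff (q q' N N' : ℕ) :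
    (factorAt (thueMorse m) q N).Perm (factorAt (thueMorse m) q' N') ↔
      ∀ a, prefixCount m a (q + N) - prefixCount m a q =
        prefixCount m a (q' + N') - prefixCount m a q' := by
  rw [List.perm_iff_count]
  refine forall_congr' fun a => ?_
  rw [← count_factorAt, ← count_factorAt, Nat.cast_inj]

theorem factorAt_block_eq (hm : 2 ≤ m) (j : ℕ) {q q' r : ℕ} (hr : r ≤ m ^ j)
    (h : r ≠ 0 → thueMorse m q = thueMorse m q') :
    factorAt (thueMorse m) (m ^ j * q) r = factorAt (thueMorse m) (m ^ j * q') r := by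
  by_cases h0 : r = 0
  · simp [h0, factorAt]
  · have key : ∀ q, factorAt (thueMorse m) (m ^ j * q) r =
        ((sigma m)^[j] [thueMorse m q]).take r := by
      intro q
      rw [← factorAt_one, sigma_iterate_factorAt hm, mul_one]
      have := factorAt_add (thueMorse m) (m ^ j * q) r (m ^ j - r)
      rw [Nat.add_sub_cancel' hr] at this
      rw [this, List.take_left' (by simp [factorAt])]
    rw [key, key, h h0]

/-- A factor completed on the left to a union of blocks. -/
theorem factorAt_blocks (hm : 2 ≤ m) (j p n : ℕ) :
    factorAt (thueMorse m) (m ^ j * (p / m ^ j)) (p % m ^ j) ++ factorAt (thueMorse m) p n =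
      (sigma m)^[j] (factorAt (thueMorse m) (p / m ^ j) ((p + n) / m ^ j - p / m ^ j)) ++
        factorAt (thueMorse m) (m ^ j * ((p + n) / m ^ j)) ((p + n) % m ^ j) := by
  have h1 := Nat.div_add_mod p (m ^ j)
  have h2 := Nat.div_add_mod (p + n) (m ^ j)
  have h3 : m ^ j * (p / m ^ j) + m ^ j * ((p + n) / m ^ j - p / m ^ j) =
      m ^ j * ((p + n) / m ^ j) := by
    rw [← mul_add, Nat.add_sub_cancel' (Nat.div_le_div_right (Nat.le_add_right p n))]
  have h4 := factorAt_add (thueMorse m) (m ^ j * (p / m ^ j)) (p % m ^ j) n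
  have h5 := factorAt_add (thueMorse m) (m ^ j * (p / m ^ j))
    (m ^ j * ((p + n) / m ^ j - p / m ^ j)) ((p + n) % m ^ j)
  rw [h1] at h4
  rw [h3] at h5
  rw [sigma_iterate_factorAt hm, ← h4, ← h5]
  congr 1
  omega

/-- Both factors are completed on the left by the same piece of a block, which leaves full blocks
followed by a common right piece (`factorAt_blocks`). Common prefixes and suffixes cancel. -/
theorem binomEquiv_factorAt_iff (hm : 2 ≤ m) {j k n p p' : ℕ} (hp : p % m ^ j = p' % m ^ j)
    (hc : p % m ^ j ≠ 0 → thueMorse m (p / m ^ j) = thueMorse m (p' / m ^ j))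
    (hb : (p + n) % m ^ j ≠ 0 →
      thueMorse m ((p + n) / m ^ j) = thueMorse m ((p' + n) / m ^ j)) :
    BinomEquiv k (factorAt (thueMorse m) p n) (factorAt (thueMorse m) p' n) ↔
      BinomEquiv k
        ((sigma m)^[j] (factorAt (thueMorse m) (p / m ^ j) ((p + n) / m ^ j - p / m ^ j)))
        ((sigma m)^[j] (factorAt (thueMorse m) (p' / m ^ j) ((p' + n) / m ^ j - p' / m ^ j))) := by
  have hm0 : 0 < m ^ j := pow_pos (by omega) j
  have hpn : (p + n) % m ^ j = (p' + n) % m ^ j := by rw [Nat.add_mod, hp, ← Nat.add_mod]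
  have e := factorAt_blocks hm j p n
  have e' := factorAt_blocks hm j p' n
  rw [← hp, ← hpn, ← factorAt_block_eq hm j (Nat.mod_lt _ hm0).le hc,
    ← factorAt_block_eq hm j (Nat.mod_lt _ hm0).le hb] at e'
  constructor
  · intro h
    have := (BinomEquiv.refl k (factorAt (thueMorse m) (m ^ j * (p / m ^ j)) (p % m ^ j))).append h
    rw [e, e'] at this
    exact this.cancel_right
  · intro h
    have := h.append (BinomEquiv.refl k
      (factorAt (thueMorse m) (m ^ j * ((p + n) / m ^ j)) ((p + n) % m ^ j)))
    rw [← e, ← e'] at this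
    exact this.cancel_left

theorem div_add_sub_div_self (B p n : ℕ) : p / B + ((p + n) / B - p / B) = (p + n) / B :=
  Nat.add_sub_cancel' (Nat.div_le_div_right (Nat.le_add_right p n))

theorem binomEquiv_of_aligned (hm : 2 ≤ m) {j n p p' : ℕ} (h : Aligned m (m ^ j) n p p') :
    BinomEquiv (j + 1) (factorAt (thueMorse m) p n) (factorAt (thueMorse m) p' n) := by
  have : NeZero m := ⟨by omega⟩
  obtain ⟨h1, h2, h3, h4⟩ := h
  rw [binomEquiv_factorAt_iff hm h1 h2 h3]
  refine BinomEquiv.sigma_iterate_of_perm j ((factorAt_perm_iff _ _ _ _).2 ?_)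
  rwa [div_add_sub_div_self, div_add_sub_div_self]

theorem aligned_of_binomEquiv (hm : 2 ≤ m) {j n p p' : ℕ} (hn : m ^ (j + 1) ≤ n)
    (h : BinomEquiv (j + 1) (factorAt (thueMorse m) p n) (factorAt (thueMorse m) p' n)) :
    Aligned m (m ^ j) n p p' := by
  have : NeZero m := ⟨by omega⟩
  induction j with
  | zero =>
    rw [zero_add, binomEquiv_one_iff_perm, factorAt_perm_iff] at h
    simpa [Aligned, Nat.mod_one] using h
  | succ j ih =>
    have hm0 : 0 < m ^ j := pow_pos (by omega) j
    have hle : m ^ (j + 1) ≤ m ^ (j + 2) := Nat.pow_le_pow_right (by omega) (by omega)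
    obtain ⟨h1, h2, h3, h4⟩ := ih (hle.trans hn) (h.mono (by omega))
    rw [binomEquiv_factorAt_iff hm h1 h2 h3] at h
    have hlen : (p + n) / m ^ j - p / m ^ j = (p' + n) / m ^ j - p' / m ^ j := by
      have e1 := add_div_sub_div p n hm0
      have e2 := add_div_sub_div p' n hm0
      rw [h1] at e1
      omega
    have hq := div_add_sub_div_self (m ^ j) p n
    have hq' := div_add_sub_div_self (m ^ j) p' n
    rw [← hlen] at hq' h
    set N := (p + n) / m ^ j - p / m ^ j with hN
    -- From m^(j+2) ≤ n < m^j (N + 1) one gets N ≥ m², which is at least 2m.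
    have hNm : 2 * m ≤ N := by
      have e1 := Nat.lt_mul_div_succ (p + n) hm0
      have e2 := Nat.mul_div_le p (m ^ j)
      rw [← hq] at e1
      have e4 : m ^ j * (m * m) ≤ n := by rw [← mul_assoc, ← pow_succ, ← pow_succ]; exact hn
      have e5 : m * m < N + 1 := by
        refine lt_of_mul_lt_mul_left (a := m ^ j) ?_ (Nat.zero_le _)
        linarith
      nlinarith
    have hperm : (factorAt (thueMorse m) (p / m ^ j) N).Perm
        (factorAt (thueMorse m) (p' / m ^ j) N) := by
      rw [factorAt_perm_iff, hq, hq']; exact h4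
    have hw : ∀ g : ZMod m → ℤ, suffixWeight g (factorAt (thueMorse m) (p / m ^ j) N) =
        suffixWeight g (factorAt (thueMorse m) (p' / m ^ j) N) := by
      intro g
      rw [suffixWeight_eq_sum g, suffixWeight_eq_sum g]
      exact Finset.sum_congr rfl fun b _ => by rw [suffixWeight_eq_of_binomEquiv j hperm h]
    obtain ⟨g1, g2, g3, g4⟩ := alignment_of_weights_eq hm (p := p / m ^ j) (p' := p' / m ^ j) hNm
      (fun g => by
        have := (hperm.map g).sum_eq
        rwa [factorAt, factorAt, List.map_map, List.map_map, sum_map_range, sum_map_range] at this)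
      (fun g => by
        have := hw g
        rwa [factorAt, factorAt, suffixWeight_map_range, suffixWeight_map_range] at this)
    have gN : (p / m ^ j + N) % m = (p' / m ^ j + N) % m := by
      rw [Nat.add_mod, g1, ← Nat.add_mod]
    have hpn : (p + n) % m ^ j = (p' + n) % m ^ j := by rw [Nat.add_mod, h1, ← Nat.add_mod]
    rw [hq, hq'] at g3 g4 gN
    -- An end may be off the grid at the coarse level because of either level. If it is on the grid
    -- of σ_m-blocks, the coarse letter equals the fine one, which is known from level j.
    have compose : ∀ {x x' : ℕ}, x % m ^ j = x' % m ^ j →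
        (x % m ^ j ≠ 0 → thueMorse m (x / m ^ j) = thueMorse m (x' / m ^ j)) →
        x / m ^ j % m = x' / m ^ j % m →
        (x / m ^ j % m ≠ 0 → thueMorse m (x / m ^ j / m) = thueMorse m (x' / m ^ j / m)) →
        x % (m ^ j * m) ≠ 0 → thueMorse m (x / m ^ j / m) = thueMorse m (x' / m ^ j / m) := by
      intro x x' k1 k2 k3 k4 k5
      by_cases hx : x / m ^ j % m = 0
      · rw [← thueMorse_of_dvd hm (Nat.dvd_of_mod_eq_zero hx),
          ← thueMorse_of_dvd hm (Nat.dvd_of_mod_eq_zero (k3.symm.trans hx))]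
        refine k2 fun h0 => k5 ?_
        rw [Nat.mod_mul, h0, hx, mul_zero, add_zero]
      · exact k4 hx
    rw [pow_succ, Aligned]
    simp only [← Nat.div_div_eq_div_mul]
    refine ⟨?_, compose h1 h2 g1 g2, compose hpn h3 gN g3, fun a => ?_⟩
    · rw [Nat.mod_mul, Nat.mod_mul, h1, g1]
    · have := g4 fun z => if z = a then 1 else 0
      rwa [Finset.sum_Ico_eq_sub _ (Nat.div_le_div_right (Nat.div_le_div_right (by omega))),
        Finset.sum_Ico_eq_sub _ (Nat.div_le_div_right (Nat.div_le_div_right (by omega)))] at this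

/-- The relation between the offsets and end blocks of two factors of length `n` that expresses
that they are aligned. -/
def DataRel (m B n : ℕ) (d d' : Fin (B * m) × ZMod m × ZMod m) : Prop :=
  (d.1 : ℕ) % B = d'.1 % B ∧
  ((d.1 : ℕ) % B ≠ 0 →
    d.2.1 + ((d.1 / B : ℕ) : ZMod m) = d'.2.1 + ((d'.1 / B : ℕ) : ZMod m)) ∧
  ((d.1 + n) % B ≠ 0 →
    d.2.2 + (((d.1 + n) % (B * m) / B : ℕ) : ZMod m) =
      d'.2.2 + (((d'.1 + n) % (B * m) / B : ℕ) : ZMod m)) ∧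
  ∀ z : ZMod m,
    (((d.1 + n) / (B * m) : ℕ) : ℤ) + blockPrefixCount d.2.2 z ((d.1 + n) % (B * m) / B) -
        blockPrefixCount d.2.1 z (d.1 / B) =
    (((d'.1 + n) / (B * m) : ℕ) : ℤ) + blockPrefixCount d'.2.2 z ((d'.1 + n) % (B * m) / B) -
        blockPrefixCount d'.2.1 z (d'.1 / B)

/-- Residues do not change, and both quotients by `B * m` grow by one, which cancels in the count
condition. -/
theorem dataRel_add_period {B : ℕ} (hB : 0 < B * m) (n : ℕ)
    (d d' : Fin (B * m) × ZMod m × ZMod m) :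
    DataRel m B (n + B * m) d d' ↔ DataRel m B n d d' := by
  simp only [DataRel, ← add_assoc, Nat.add_mod_right, Nat.add_mul_mod_self_left,
    Nat.add_div_right _ hB, Nat.cast_succ, add_right_comm _ (1 : ℤ), add_sub_right_comm _ (1 : ℤ),
    add_left_inj]

/-- The offset and the end blocks of the factor of length `n` at `p`. -/
def factorData (m B n : ℕ) (hB : 0 < B * m) (p : ℕ) : Fin (B * m) × ZMod m × ZMod m :=
  (⟨p % (B * m), Nat.mod_lt _ hB⟩, thueMorse m (p / (B * m)), thueMorse m ((p + n) / (B * m)))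

/-- Looking one level higher removes the interior: every complete σ_m-block contains each letter
once, so the letter counts depend only on the number of such blocks and on the two ends. -/
theorem aligned_iff_dataRel (hm : 2 ≤ m) {B : ℕ} (hB : 0 < B * m) (n p p' : ℕ) :
    Aligned m B n p p' ↔ DataRel m B n (factorData m B n hB p) (factorData m B n hB p') := by
  have e1 : ∀ x, thueMorse m (x / B) =
      thueMorse m (x / (B * m)) + ((x % (B * m) / B : ℕ) : ZMod m) := by
    intro x
    rw [thueMorse_eq hm, Nat.div_div_eq_div_mul, Nat.mod_mul_right_div_self]
  have e2 : ∀ a x, prefixCount m a (x / B) = (x / (B * m) : ℕ) +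
      blockPrefixCount (thueMorse m (x / (B * m))) a (x % (B * m) / B) := by
    intro a x
    rw [prefixCount_eq hm, Nat.div_div_eq_div_mul, Nat.mod_mul_right_div_self]
  have e3 : ∀ x, x % (B * m) % B = x % B := fun x => Nat.mod_mod_of_dvd x (dvd_mul_right B m)
  have e4 : ∀ x, (x % (B * m) + n) % B = (x + n) % B := fun x => by
    rw [Nat.add_mod, e3, ← Nat.add_mod]
  simp only [Aligned, DataRel, factorData, e1, e2, e3, e4, Nat.mod_add_mod,
    ← add_div_sub_div _ n hB]
  refine and_congr_right fun _ => and_congr_right fun _ => and_congr_right fun _ =>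
    forall_congr' fun z => ?_
  constructor <;> intro h <;> linarith

/-- The bound on `n` puts the two ends in different blocks of length `B * m`, at a distance fixed by
the offset, and `exists_thueMorse_pair` realises any two letters there. -/
theorem factorData_surjective (hm : 2 ≤ m) {B : ℕ} (hB : 0 < B * m) {n : ℕ} (hn : B * m ≤ n) :
    Function.Surjective (factorData m B n hB) := by
  rintro ⟨⟨r, hr⟩, a, b⟩
  obtain ⟨q, h1, h2⟩ := exists_thueMorse_pair hm ((r + n) / (B * m))
    (Nat.div_pos (by omega) hB) a b
  refine ⟨B * m * q + r, ?_⟩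
  simp only [factorData, Prod.mk.injEq, Fin.mk.injEq]
  refine ⟨by rw [Nat.mul_add_mod, Nat.mod_eq_of_lt hr], ?_, ?_⟩
  · rw [Nat.mul_add_div hB, Nat.div_eq_of_lt hr, add_zero, h1]
  · rw [add_assoc, Nat.mul_add_div hB, h2]

/-- The number of binomial equivalence classes is determined by `DataRel`. -/
theorem binomComplexity_eq (hm : 2 ≤ m) (j : ℕ) {n : ℕ} (hn : m ^ j * m ≤ n)
    (s : Setoid (Fin (m ^ j * m) × ZMod m × ZMod m))
    (hs : ∀ d d', s d d' ↔ DataRel m (m ^ j) n d d') :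
    binomComplexity (j + 1) (thueMorse m) n = Nat.card (Quotient s) := by
  have hB : 0 < m ^ j * m := mul_pos (pow_pos (by omega) j) (by omega)
  have hsurj := factorData_surjective hm hB hn
  have key : ∀ p p', BinomEquiv (j + 1) (factorAt (thueMorse m) p n) (factorAt (thueMorse m) p' n) ↔
      s (factorData m (m ^ j) n hB p) (factorData m (m ^ j) n hB p') := by
    intro p p'
    rw [hs, ← aligned_iff_dataRel hm]
    exact ⟨aligned_of_binomEquiv hm (by rwa [pow_succ]), binomEquiv_of_aligned hm⟩
  -- A triple is sent to the class of a factor at any position realising it; `key` gives both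
  -- well-definedness and injectivity.
  refine (Nat.card_eq_of_bijective (fun c : Quotient s => Quotient.liftOn c (fun d =>
    (Quotient.mk (factorSetoid (j + 1) (thueMorse m) n)
      ⟨factorAt (thueMorse m) (Function.surjInv hsurj d) n, _, rfl⟩))
      ?_) ⟨?_, ?_⟩).symm
  · intro d d' h
    refine Quotient.sound ((key _ _).2 ?_)
    rwa [Function.surjInv_eq hsurj, Function.surjInv_eq hsurj]
  · intro c c'
    induction c, c' using Quotient.inductionOn₂ with
    | _ d d' =>
      intro h
      have := (key _ _).1 (Quotient.exact h)
      rw [Function.surjInv_eq hsurj, Function.surjInv_eq hsurj] at this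
      exact Quotient.sound this
  · intro c
    induction c using Quotient.inductionOn with
    | _ u =>
      obtain ⟨u, p, rfl⟩ := u
      refine ⟨Quotient.mk s (factorData m (m ^ j) n hB p), Quotient.sound ((key _ _).2 ?_)⟩
      rw [Function.surjInv_eq hsurj]

/-- Symmetry and transitivity are inherited from binomial equivalence, since every triple comes from
a factor. -/
theorem exists_setoid_dataRel (hm : 2 ≤ m) (j : ℕ) {n : ℕ} (hn : m ^ j * m ≤ n) :
    ∃ s : Setoid (Fin (m ^ j * m) × ZMod m × ZMod m),
      ∀ d d', s d d' ↔ DataRel m (m ^ j) n d d' := by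
  have hB : 0 < m ^ j * m := mul_pos (pow_pos (by omega) j) (by omega)
  have hsurj := factorData_surjective hm hB hn
  refine ⟨⟨DataRel m (m ^ j) n, ?_, ?_, ?_⟩, fun _ _ => Iff.rfl⟩
  · intro d
    refine ⟨rfl, fun _ => rfl, fun _ => rfl, fun _ => rfl⟩
  · rintro d d' h
    obtain ⟨p, rfl⟩ := hsurj d
    obtain ⟨p', rfl⟩ := hsurj d'
    rw [← aligned_iff_dataRel hm] at h ⊢
    exact aligned_of_binomEquiv hm (by rwa [pow_succ]) (binomEquiv_of_aligned hm h).symm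
  · rintro d d' d'' h h'
    obtain ⟨p, rfl⟩ := hsurj d
    obtain ⟨p', rfl⟩ := hsurj d'
    obtain ⟨p'', rfl⟩ := hsurj d''
    rw [← aligned_iff_dataRel hm] at h h' ⊢
    exact aligned_of_binomEquiv hm (by rwa [pow_succ])
      ((binomEquiv_of_aligned hm h).trans (binomEquiv_of_aligned hm h'))

end Characterization

end GenThueMorse

theorem mainTheorem3 (m k : ℕ) (hm : 2 ≤ m) (hk : 2 ≤ k) :
    ∀ n : ℕ, m ^ k ≤ n →
      GenThueMorse.binomComplexity k (GenThueMorse.thueMorse m) (n + m ^ k) =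
        GenThueMorse.binomComplexity k (GenThueMorse.thueMorse m) n := by
  intro n hn
  obtain ⟨j, rfl⟩ : ∃ j, k = j + 1 := ⟨k - 1, by omega⟩
  have hB : 0 < m ^ j * m := mul_pos (pow_pos (by omega) j) (by omega)
  rw [pow_succ] at hn ⊢
  obtain ⟨s, hs⟩ := GenThueMorse.exists_setoid_dataRel hm j hn
  -- The same setoid serves the lengths n and n + m^k.
  rw [GenThueMorse.binomComplexity_eq hm j hn s hs,
    GenThueMorse.binomComplexity_eq hm j (by omega) s fun d d' => by
      rw [hs, GenThueMorse.dataRel_add_period hB]]
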